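/- Let $F$ be a field of characteristic $0$ containing $\sqrt{-1}$, with algebraic closure $\overline F$. Let $G$ be a finite metabelian group with a maximal abelian normal subgroup $K$ that contains the derived subgroup $G'$ and is cyclic of order $2^n$, where $n$ is a positive integer. Let $\rho$ be a faithful irreducible $\overline F$-representation of $G$ with character $\chi$, and let $\lambda$ be an irreducible constituent of the restriction $\rho\downarrow^G_K$. Write $F(\chi)$ and $F(\lambda)$ for the subfields of $\overline F$ obtained by adjoining to $F$ the values of $\chi$ and of the character of $\lambda$, write $\zeta_r$ for a primitive $r$-th root of unity, and for $g\in G$ let $\lambda^g(k)=\lambda(gkg^{-1})$ for $k\in K$. Let $$I=\{g\in G : \text{there exists } \tau(g)\in \mathrm{Gal}(F(\lambda)/F) \text{ such that } \lambda^g=\lambda^{\tau(g)}\}.$$ Then the following hold. (1) $\lambda$ is faithful, $\rho\cong\lambda\uparrow_K^G$, $F(\lambda)=F(\zeta_{2^n})$, $F(\chi)\subseteq F(\lambda)$ is a Galois extension, and $I/K\cong \mathrm{Gal}(F(\lambda)/F(\chi))$ is a cyclic $2$-group. (2) Suppose that $I=G$; thus $G/K=\langle yK\rangle\cong C_{2^l}$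 for some $y\in G$ and $l\ge 0$. For every such $y$ and $l$ there is an automorphism $\sigma\in\mathrm{Gal}(F(\lambda)/F)$ such that $\lambda^y=\lambda^\sigma$ and $F(\chi)$ is the subfield of $F(\lambda)$ fixed by $\sigma$. There is a unique primitive central idempotent $e$ of $F[G]$ with $\chi(e)\neq 0$, and the Wedderburn component $F[G]e$ corresponding to $\rho$ is isomorphic, as an $F$-algebra, to the matrix algebra $M_{2^l}(F(\chi))$. Furthermore, $F(\chi)=F(\zeta_{2^m})$ for some $m\ge 2$. -/

import Mathlib

open scoped MonoidAlgebra IntermediateField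

/-- `F(χ)`: the field obtained from `F` by adjoining all values of the function `χ`. -/
def charField (F : Type*) {Ω H : Type*} [Field F] [Field Ω] [Algebra F Ω] (χ : H → Ω) :
    IntermediateField F Ω :=
  IntermediateField.adjoin F (Set.range χ)

theorem mem_charField (F : Type*) {Ω H : Type*} [Field F] [Field Ω] [Algebra F Ω] (χ : H → Ω)
    (h : H) : χ h ∈ charField F χ :=
  IntermediateField.subset_adjoin F _ ⟨h, rfl⟩

/-- `lam^g = lam^τ` for a representation `lam` of the normal subgroup `K` of `G`, an element
`g : G` and an `F`-automorphism `τ` of `F(lam)`: here `lam^g (k) = lam (g k g⁻¹)`, the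
automorphism `τ` acts on the values, and the two sides are compared through their characters. -/
def ConjEqGalois (F : Type*) {Ω G W : Type*} [Field F] [Field Ω] [Algebra F Ω] [Group G]
    {K : Subgroup G} [hK : K.Normal] [AddCommGroup W] [Module Ω W]
    (lam : Representation Ω K W) (g : G) (τ : Gal(charField F lam.character/F)) : Prop :=
  ∀ k : K, lam.character ⟨g * k * g⁻¹, hK.conj_mem k k.2 g⟩ =
    (τ ⟨lam.character k, mem_charField F lam.character k⟩ : Ω)

/-- `I = {g ∈ G : there is τ(g) ∈ Gal(F(lam)/F) with lam^g = lam^τ(g)}`, a subgroup of `G`. -/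
def galoisInertia (F : Type*) {Ω G W : Type*} [Field F] [Field Ω] [Algebra F Ω] [Group G]
    {K : Subgroup G} [hK : K.Normal] [AddCommGroup W] [Module Ω W]
    (lam : Representation Ω K W) : Subgroup G where
  carrier := {g | ∃ τ : Gal(charField F lam.character/F), ConjEqGalois F lam g τ}
  one_mem' := ⟨1, fun k => by simp⟩
  mul_mem' := by
    rintro a b ⟨σ, hσ⟩ ⟨τ, hτ⟩
    refine ⟨σ * τ, fun k => ?_⟩
    have h1 := hσ ⟨b * k * b⁻¹, hK.conj_mem k k.2 b⟩
    have h2 : (⟨lam.character ⟨b * k * b⁻¹, hK.conj_mem k k.2 b⟩, mem_charField F _ _⟩ :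
        charField F lam.character) = τ ⟨lam.character k, mem_charField F _ k⟩ :=
      Subtype.ext (hτ k)
    rw [h2] at h1
    rw [AlgEquiv.mul_apply, ← h1]
    congr 2
    simp [mul_assoc]
  inv_mem' := by
    rintro a ⟨σ, hσ⟩
    refine ⟨σ⁻¹, fun k => ?_⟩
    have h1 := hσ ⟨a⁻¹ * k * a⁻¹⁻¹, hK.conj_mem k k.2 a⁻¹⟩
    have h2 : (⟨a * (a⁻¹ * k * a⁻¹⁻¹) * a⁻¹,
        hK.conj_mem _ (hK.conj_mem k k.2 a⁻¹) a⟩ : K) = k :=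
      Subtype.ext (by simp [mul_assoc])
    have h3 : (⟨lam.character k, mem_charField F _ k⟩ : charField F lam.character) =
        σ ⟨lam.character ⟨a⁻¹ * k * a⁻¹⁻¹, hK.conj_mem k k.2 a⁻¹⟩, mem_charField F _ _⟩ :=
      Subtype.ext (by rw [← h1]; exact congrArg lam.character h2.symm)
    have h4 : ∀ x : charField F lam.character, σ⁻¹ (σ x) = x := fun x =>
      AlgEquiv.symm_apply_apply σ x
    rw [h3, h4]

theorem le_galoisInertia (F : Type*) {Ω G W : Type*} [Field F] [Field Ω] [Algebra F Ω] [Group G]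
    {K : Subgroup G} [K.Normal] [AddCommGroup W] [Module Ω W]
    (lam : Representation Ω K W) : K ≤ galoisInertia F lam := fun g hg =>
  ⟨1, fun k => lam.char_conj k ⟨g, hg⟩⟩

/-- A primitive central idempotent of a ring: a nonzero central idempotent that is not the sum
of two nonzero orthogonal central idempotents. -/
structure IsPrimitiveCentralIdempotent {R : Type*} [Ring R] (e : R) : Prop where
  mem_center : e ∈ Subring.center R
  idem : IsIdempotentElem e
  ne_zero : e ≠ 0
  primitive : ∀ f g : R, f ∈ Subring.center R → g ∈ Subring.center R → IsIdempotentElem f →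
    IsIdempotentElem g → f * g = 0 → e = f + g → f = 0 ∨ g = 0

/-- The `F`-linear extension of `χ : G → Ω` to the group algebra `F[G]`, evaluated at `a`. -/
noncomputable def charEval {F Ω G : Type*} [Field F] [Field Ω] [Algebra F Ω] [Group G]
    (χ : G → Ω) (a : F[G]) : Ω :=
  a.coeff.sum fun g c => c • χ g

/-- `e` is the primitive central idempotent of `F[G]` that corresponds to the
character `χ`, i.e. the one on which `χ` does not vanish. -/
structure IsBlockIdempotent {F Ω G : Type*} [Field F] [Field Ω] [Algebra F Ω] [Group G]
    (χ : G → Ω) (e : F[G]) : Prop extends IsPrimitiveCentralIdempotent e where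
  charEval_ne_zero : charEval χ e ≠ 0

/-- The corner `e R e` (equal to `R e` for central `e`), a ring with identity `e`, is an algebra
over the base field of `R`. -/
instance cornerAlgebra {F R : Type*} [Field F] [Ring R] [Algebra F R] {e : R}
    (he : IsIdempotentElem e) : Algebra F he.Corner where
  smul c a := ⟨c • a.1, by
    obtain ⟨r, hr⟩ := a.2
    exact ⟨c • r, by simp [← hr]⟩⟩
  algebraMap :=
    { toFun := fun c => ⟨c • e, c • e, by simp [he.eq]⟩
      map_one' := Subtype.ext (one_smul F e)
      map_mul' := fun c d => Subtype.ext (by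
        change (c * d) • e = (c • e) * (d • e)
        rw [smul_mul_smul_comm, he.eq])
      map_zero' := Subtype.ext (zero_smul F e)
      map_add' := fun c d => Subtype.ext (add_smul c d e) }
  commutes' c a := Subtype.ext (by
    change (c • e) * a.1 = a.1 * (c • e)
    have h := (Subsemigroup.mem_corner_iff he).mp a.2
    rw [smul_mul_assoc, mul_smul_comm, h.1, h.2])
  smul_def' c a := Subtype.ext (by
    change c • a.1 = (c • e) * a.1
    rw [smul_mul_assoc, ((Subsemigroup.mem_corner_iff he).mp a.2).1])

/-- The Wedderburn component `F[G] e` of `F[G]` corresponding to `χ`, where `e` is the primitive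
central idempotent that corresponds to `χ`; its identity element is `e`. -/
abbrev WedderburnComponent {F Ω G : Type*} [Field F] [Field Ω] [Algebra F Ω] [Group G]
    {χ : G → Ω} {e : F[G]} (he : IsBlockIdempotent χ e) : Type _ :=
  he.idem.Corner

/-!
Since `K` is maximal among the abelian normal subgroups and contains the commutator subgroup, it is
its own centralizer (`mem_of_forall_commute_of_maximal`). Let `φ` be the linear character of `lam`
and `v` a vector of `ρ` on which `K` acts through `φ`. Subgroups of the cyclic group `K` are normal
in `G`, so `φ` is faithful; its conjugates along `G ⧸ K` are then distinct, and the translates of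
`v` form a basis of `ρ` (`exists_basis_translates`). This shows that `ρ` is induced from `lam`, that
its character `χ` vanishes off `K`, and that on `K` it is the sum of the conjugates of `φ`.

By the linear independence of characters, an automorphism of `F(lam)` fixes `F(χ)` exactly when it
permutes the conjugates of `φ`. Hence `I / K` is `Gal(F(lam)/F(χ))` (`exists_galoisInertia_hom`), and
because `√-1 ∈ F` this embeds, for `n ≥ 2`, in the group of units of `ℤ/2ⁿ` congruent to `1` modulo
`4`, which is cyclic.

Suppose `I = G`, and let `y` generate `G ⧸ K`, of order `2 ^ l`. It acts on `K` as
`k ↦ k ^ (q + 1)` with `4 ∣ q` (unless `G = K`). The sum `∑ i < 2 ^ l, (q + 1) ^ i` has `2`-adic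
valuation exactly `l`, so every element of `K` fixed by `y` is a norm, and the extension of `G ⧸ K`
by `K` splits (`exists_mul_pow_eq_one`). For a split extension, `F(lam)` itself becomes an
`F(χ)`-linear representation of `G` with character `χ`: `K` acts by multiplication and the
complement by Galois automorphisms. By Dedekind's lemma the group algebra maps onto all
`F(χ)`-linear endomorphisms of `F(lam)`, and semisimplicity identifies the block of `χ` with this
matrix algebra (`block_of_cocycle`). Finally, `F(χ)` contains `ζ ^ 2 ^ l`, where `ζ` is a primitive
`2 ^ n`-th root of unity, and comparing degrees gives `F(χ) = F(ζ ^ 2 ^ l)`.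
-/

/-! ### Normal cyclic subgroups containing the commutator subgroup -/

/-- A maximal abelian normal subgroup `K` containing the commutator subgroup is self-centralizing:
every subgroup above `K` is normal, so `K` may be enlarged by any element centralizing it. -/
theorem mem_of_forall_commute_of_maximal {G : Type*} [Group G] {K : Subgroup G}
    (hKmax : Maximal (fun H : Subgroup G => H.Normal ∧ IsMulCommutative H) K)
    (hKG : commutator G ≤ K) {g : G} (hg : ∀ k ∈ K, g * k * g⁻¹ = k) : g ∈ K := by
  have hcomm : ∀ a ∈ K, ∀ b ∈ K, a * b = b * a := fun a ha b hb => by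
    have := hKmax.prop.2
    exact congrArg Subtype.val (mul_comm' (⟨a, ha⟩ : K) ⟨b, hb⟩)
  have hgc : ∀ a ∈ K, g * a = a * g := fun a ha => by
    simpa [mul_inv_eq_iff_eq_mul] using hg a ha
  have hle : K ≤ Subgroup.closure (insert g (K : Set G)) := fun x hx =>
    Subgroup.subset_closure (Set.mem_insert_of_mem _ hx)
  refine hKmax.le_of_ge (y := Subgroup.closure (insert g (K : Set G)))
    ⟨Subgroup.Normal.of_commutator_le _ (hKG.trans hle), ?_⟩ hle
    (Subgroup.subset_closure (Set.mem_insert _ _))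
  refine Subgroup.isMulCommutative_closure ?_
  rintro a (rfl | ha) b (rfl | hb)
  · rfl
  · exact hgc b hb
  · exact (hgc a ha).symm
  · exact hcomm a ha b hb

/-- Conjugation on a finite cyclic normal subgroup is a power map. The exponent is written as
`q + 1`, so that the geometric sums below have the closed form
`q * ∑ i ∈ range N, (q + 1) ^ i = (q + 1) ^ N - 1`. -/
theorem exists_conj_eq_pow {G : Type*} [Group G] [Finite G] (K : Subgroup G) [hK : K.Normal]
    [IsCyclic K] (g : G) : ∃ q : ℕ, ∀ k ∈ K, g * k * g⁻¹ = k ^ (q + 1) := by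
  obtain ⟨m, hm⟩ := MonoidHom.map_cyclic (MulAut.conjNormal (H := K) g).toMonoidHom
  have hpos : 0 < Nat.card K := Nat.card_pos
  obtain ⟨q, hq⟩ : ∃ q : ℕ, (q : ℤ) = m % Nat.card K + Nat.card K - 1 := by
    have := Int.emod_nonneg m (b := Nat.card K) (by omega)
    exact ⟨(m % Nat.card K + Nat.card K - 1).toNat, Int.toNat_of_nonneg (by omega)⟩
  refine ⟨q, fun k hk => ?_⟩
  have h1 := congrArg Subtype.val (hm ⟨k, hk⟩)
  have h2 : (⟨k, hk⟩ : K) ^ m = ⟨k, hk⟩ ^ (q + 1) := by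
    rw [← zpow_natCast]
    have h3 : ((q + 1 : ℕ) : ℤ) = m % Nat.card K + Nat.card K := by push_cast; omega
    rw [h3, zpow_add, zpow_natCast, pow_card_eq_one', mul_one, zpow_mod_natCard]
  rw [h2] at h1
  simpa using h1

theorem conj_pow_eq_pow_pow {G : Type*} [Group G] {K : Subgroup G} {y : G} {q : ℕ}
    (hy : ∀ k ∈ K, y * k * y⁻¹ = k ^ (q + 1)) {k : G} (hk : k ∈ K) (j : ℕ) :
    y ^ j * k * (y ^ j)⁻¹ = k ^ (q + 1) ^ j := by
  induction j with
  | zero => simp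
  | succ j ih =>
    have : y ^ (j + 1) * k * (y ^ (j + 1))⁻¹ = y * (y ^ j * k * (y ^ j)⁻¹) * y⁻¹ := by
      rw [pow_succ']; group
    rw [this, ih, hy _ (pow_mem hk _), ← pow_mul, ← pow_succ]

theorem mul_pow_eq_pow_geomSum_mul_pow {G : Type*} [Group G] {K : Subgroup G} {y : G} {q : ℕ}
    (hy : ∀ k ∈ K, y * k * y⁻¹ = k ^ (q + 1)) {k : G} (hk : k ∈ K) (N : ℕ) :
    (k * y) ^ N = k ^ (∑ i ∈ Finset.range N, (q + 1) ^ i) * y ^ N := by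
  induction N with
  | zero => simp
  | succ N ih =>
    rw [pow_succ', ih, geom_sum_succ, pow_succ' y N]
    have h := hy _ (pow_mem hk (∑ i ∈ Finset.range N, (q + 1) ^ i))
    rw [← pow_mul, mul_inv_eq_iff_eq_mul] at h
    calc k * y * (k ^ (∑ i ∈ Finset.range N, (q + 1) ^ i) * y ^ N)
        = k * (y * k ^ (∑ i ∈ Finset.range N, (q + 1) ^ i)) * y ^ N := by group
      _ = _ := by
        rw [h, mul_comm (∑ i ∈ Finset.range N, (q + 1) ^ i), pow_succ']
        group

/-- If `4 ∣ q` then `∑ i < 2 ^ l, (q + 1) ^ i` has `2`-adic valuation exactly `l`. -/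
theorem exists_odd_geomSum_two_pow {q : ℕ} (hq : 4 ∣ q) (l : ℕ) :
    ∃ u : ℕ, Odd u ∧ ∑ i ∈ Finset.range (2 ^ l), (q + 1) ^ i = 2 ^ l * u := by
  induction l with
  | zero => exact ⟨1, odd_one, by simp⟩
  | succ l ih =>
    obtain ⟨u, hu, h⟩ := ih
    obtain ⟨s, rfl⟩ := hq
    have hmod : (4 * s + 1) ^ 2 ^ l % 4 = 1 := by
      simp [Nat.pow_mod, Nat.add_mod]
    obtain ⟨w, hw⟩ : ∃ w, (4 * s + 1) ^ 2 ^ l = 4 * w + 1 :=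
      ⟨(4 * s + 1) ^ 2 ^ l / 4, by omega⟩
    refine ⟨u * (2 * w + 1), hu.mul ⟨w, rfl⟩, ?_⟩
    rw [pow_succ, mul_two, Finset.sum_range_add]
    simp_rw [pow_add]
    rw [← Finset.mul_sum, h, hw]
    ring

/-- A power of `y` lies in the self-centralizing subgroup `K` if and only if it acts trivially
on `K`. -/
theorem pow_mem_iff_card_dvd {G : Type*} [Group G] {K : Subgroup G} [IsCyclic K]
    (hcent : ∀ g : G, (∀ k ∈ K, g * k * g⁻¹ = k) → g ∈ K) {y : G} {q : ℕ}
    (hy : ∀ k ∈ K, y * k * y⁻¹ = k ^ (q + 1)) (j : ℕ) :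
    y ^ j ∈ K ↔ Nat.card K ∣ (∑ i ∈ Finset.range j, (q + 1) ^ i) * q := by
  obtain ⟨k0, hk0⟩ := IsCyclic.exists_generator (α := K)
  have hord : orderOf (k0 : G) = Nat.card K := by
    rw [Subgroup.orderOf_coe, orderOf_eq_card_of_forall_mem_zpowers hk0]
  have hpow : ∀ k ∈ K, y ^ j * k * (y ^ j)⁻¹ =
      k ^ ((∑ i ∈ Finset.range j, (q + 1) ^ i) * q) * k := fun k hk => by
    rw [conj_pow_eq_pow_pow hy hk, ← pow_succ, geom_sum_mul_add]
  constructor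
  · intro h
    rw [← hord]
    apply orderOf_dvd_of_pow_eq_one
    have h1 := hpow k0 k0.2
    have h2 : y ^ j * k0 = k0 * y ^ j :=
      congrArg Subtype.val (mul_comm' (⟨y ^ j, h⟩ : K) k0)
    rw [h2, mul_inv_cancel_right] at h1
    exact (mul_eq_right.mp h1.symm)
  · intro h
    refine hcent _ fun k hk => ?_
    obtain ⟨c, hc⟩ := h
    have : k ^ Nat.card K = 1 := congrArg Subtype.val (pow_card_eq_one' (x := (⟨k, hk⟩ : K)))
    rw [hpow k hk, hc, pow_mul, this, one_pow, one_mul]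

/-- If `G ⧸ K` is generated by the class of `y` and has order `2 ^ l`, where `y` acts on the cyclic
`2`-group `K` by `k ↦ k ^ (q + 1)` with `4 ∣ q`, then the extension splits: `y` may be multiplied
by an element of `K` so that it has order dividing `2 ^ l`.

The element `y ^ (2 ^ l)` of `K` is fixed by `y`, and the assumption on `q` makes every such element
a "norm" `k ^ (1 + (q + 1) + (q + 1) ^ 2 + ⋯)`. -/
theorem exists_mul_pow_eq_one {G : Type*} [Group G] {K : Subgroup G} [IsCyclic K]
    [Finite G] (hcent : ∀ g : G, (∀ k ∈ K, g * k * g⁻¹ = k) → g ∈ K) {n : ℕ}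
    (hcard : Nat.card K = 2 ^ n) {y : G} {q l : ℕ}
    (hy : ∀ k ∈ K, y * k * y⁻¹ = k ^ (q + 1)) (hq : l ≠ 0 → 4 ∣ q)
    (hyl : ∀ j, y ^ j ∈ K ↔ 2 ^ l ∣ j) : ∃ k ∈ K, (k * y) ^ 2 ^ l = 1 := by
  rcases l with _ | l
  · exact ⟨y⁻¹, K.inv_mem (by simpa using hyl 1), by simp⟩
  have hq4 := hq l.succ_ne_zero
  obtain ⟨k0, hk0⟩ := IsCyclic.exists_generator (α := K)
  have hord : orderOf k0 = 2 ^ n := by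
    rw [← hcard, orderOf_eq_card_of_forall_mem_zpowers hk0]
  have hyK : y ^ 2 ^ (l + 1) ∈ K := (hyl _).mpr dvd_rfl
  obtain ⟨j, hj⟩ : ∃ j : ℕ, k0 ^ j = ⟨y ^ 2 ^ (l + 1), hyK⟩ := by
    have := hk0 ⟨y ^ 2 ^ (l + 1), hyK⟩
    rwa [← mem_powers_iff_mem_zpowers] at this
  have hjv : (k0 : G) ^ j = y ^ 2 ^ (l + 1) := by
    simpa using congrArg Subtype.val hj
  -- `y` commutes with its own power, which forces `2 ^ n ∣ j * q`
  have hjq : 2 ^ n ∣ j * q := by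
    rw [← hord]
    apply orderOf_dvd_of_pow_eq_one
    have h1 := hy _ (k0 ^ j).2
    push_cast at h1
    rw [hjv, ← pow_succ', pow_succ, mul_inv_cancel_right] at h1
    rw [← hjv, pow_succ, eq_comm, mul_eq_right, ← pow_mul] at h1
    exact Subtype.ext (by simpa using h1)
  obtain ⟨u', -, hu'⟩ := exists_odd_geomSum_two_pow hq4 l
  have hnot : ¬ 2 ^ n ∣ 2 ^ l * q := by
    intro h
    have h2 : y ^ 2 ^ l ∈ K := by
      rw [pow_mem_iff_card_dvd hcent hy, hcard, hu']
      exact h.trans ⟨u', by ring⟩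
    rw [hyl, Nat.pow_dvd_pow_iff_le_right (by norm_num)] at h2
    omega
  have hdvd : 2 ^ (l + 1) ∣ j := by
    rcases eq_or_ne j 0 with rfl | hj0
    · exact dvd_zero _
    obtain ⟨a, b, hb, rfl⟩ := Nat.exists_eq_two_pow_mul_odd hj0
    by_contra hcon
    have hal : a ≤ l := by
      by_contra h
      exact hcon ((pow_dvd_pow 2 (by omega)).mul_right b)
    have h3 : 2 ^ n ∣ 2 ^ a * q := by
      have : 2 ^ n ∣ (2 ^ a * q) * b := by convert hjq using 1; ring
      exact (Nat.Coprime.pow_left n (Nat.coprime_two_left.mpr hb)).dvd_of_dvd_mul_right this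
    exact hnot (h3.trans (mul_dvd_mul_right (pow_dvd_pow 2 hal) q))
  obtain ⟨j', rfl⟩ := hdvd
  obtain ⟨u, hu, hS⟩ := exists_odd_geomSum_two_pow hq4 (l + 1)
  have hcop : (Nat.card K).Coprime u := by
    rw [hcard]; exact Nat.Coprime.pow_left n (Nat.coprime_two_left.mpr hu)
  obtain ⟨k, hk⟩ := (powCoprime hcop).surjective (k0 ^ j')⁻¹
  refine ⟨k, k.2, ?_⟩
  rw [mul_pow_eq_pow_geomSum_mul_pow hy k.2, hS, ← hjv, mul_comm _ u, pow_mul]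
  have hk' : (k : G) ^ u = ((k0 : G) ^ j')⁻¹ := by
    simpa [powCoprime] using congrArg Subtype.val hk
  rw [hk', inv_pow, ← pow_mul, mul_comm j', inv_mul_cancel]

/-- An extension by a finite cyclic quotient `G ⧸ K` of order `N` generated by the class of `y`,
where `y ^ N = 1`, splits: there is an endomorphism of `G` with kernel `K` that is the identity
modulo `K`. -/
theorem exists_retraction {G : Type*} [Group G] {K : Subgroup G} [K.Normal] {y : G}
    (hgen : Subgroup.zpowers (y : G ⧸ K) = ⊤) (hy : y ^ Nat.card (G ⧸ K) = 1) :
    ∃ π : G →* G, (∀ k ∈ K, π k = 1) ∧ ∀ g, g * (π g)⁻¹ ∈ K := by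
  let f : Subgroup.zpowers y →* G ⧸ K := (QuotientGroup.mk' K).comp (Subgroup.zpowers y).subtype
  have hf : Function.Bijective f := by
    constructor
    · rw [injective_iff_map_eq_one]
      rintro ⟨_, j, rfl⟩ hj
      have h1 : (y : G ⧸ K) ^ j = 1 := hj
      rw [← orderOf_dvd_iff_zpow_eq_one, ← Nat.card_zpowers, hgen, Subgroup.card_top] at h1
      obtain ⟨c, hc⟩ := h1
      refine Subtype.ext ?_
      change y ^ j = 1
      rw [hc, zpow_mul, zpow_natCast, hy, one_zpow]
    · intro x
      have hx : x ∈ Subgroup.zpowers (y : G ⧸ K) := hgen ▸ Subgroup.mem_top x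
      obtain ⟨j, rfl⟩ := hx
      exact ⟨⟨y ^ j, j, rfl⟩, rfl⟩
  let e := MulEquiv.ofBijective f hf
  refine ⟨(Subgroup.zpowers y).subtype.comp (e.symm.toMonoidHom.comp (QuotientGroup.mk' K)),
    fun k hk => ?_, fun g => ?_⟩
  · have : (k : G ⧸ K) = 1 := (QuotientGroup.eq_one_iff k).mpr hk
    simp [this]
  · have h1 : f (e.symm (g : G ⧸ K)) = (g : G ⧸ K) := e.apply_symm_apply _
    rw [← QuotientGroup.eq_one_iff, QuotientGroup.mk_mul, QuotientGroup.mk_inv]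
    exact mul_inv_eq_one.mpr h1.symm

theorem pow_mem_iff_of_zpowers_eq_top {G : Type*} [Group G] {K : Subgroup G} [K.Normal] {y : G}
    (hgen : Subgroup.zpowers (y : G ⧸ K) = ⊤) (j : ℕ) : y ^ j ∈ K ↔ Nat.card (G ⧸ K) ∣ j := by
  rw [← QuotientGroup.eq_one_iff, QuotientGroup.mk_pow, ← orderOf_dvd_iff_pow_eq_one,
    ← Nat.card_zpowers, hgen, Subgroup.card_top]

/-! ### Representations induced from a linear character of a cyclic normal subgroup -/

/-- An irreducible representation of a commutative group over an algebraically closed field is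
given by a linear character, which is its character. -/
theorem Representation.IsIrreducible.exists_linearCharacter {Ω H W : Type*} [Field Ω]
    [IsAlgClosed Ω] [Group H] [IsMulCommutative H] [AddCommGroup W] [Module Ω W]
    [FiniteDimensional Ω W] {lam : Representation Ω H W} (hlam : lam.IsIrreducible) :
    ∃ φ : H →* Ω, (∀ h w, lam h w = φ h • w) ∧ lam.character = φ := by
  have h1 : Module.finrank Ω W = 1 := hlam.finrank_eq_one_of_isMulCommutative lam
  have hc : ∀ h, ∃ c : Ω, lam h = c • LinearMap.id := fun h => by
    obtain ⟨w, hw, hspan⟩ := finrank_eq_one_iff'.mp h1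
    obtain ⟨c, hc⟩ := hspan (lam h w)
    refine ⟨c, LinearMap.ext fun v => ?_⟩
    obtain ⟨d, rfl⟩ := hspan v
    simp [← hc]
  have hdet : ∀ h c, lam h = c • LinearMap.id → LinearMap.det (lam h) = c := fun h c hc => by
    rw [hc, LinearMap.det_smul, h1, LinearMap.det_id, pow_one, mul_one]
  refine ⟨LinearMap.det.comp lam, fun h w => ?_, funext fun h => ?_⟩
  · obtain ⟨c, hc⟩ := hc h
    rw [MonoidHom.comp_apply, hdet h c hc, hc]
    simp
  · obtain ⟨c, hc⟩ := hc h
    rw [MonoidHom.comp_apply, hdet h c hc, Representation.character, hc, map_smul,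
      LinearMap.trace_id, h1]
    simp

section

variable {Ω G V : Type*} [Field Ω] [Group G] [AddCommGroup V] [Module Ω V]
  {K : Subgroup G} {ρ : Representation Ω G V} {φ : K →* Ω} {v : V}

/-- If a faithful irreducible representation of `G` restricted to a finite cyclic normal subgroup
contains the linear character `φ`, then `φ` is faithful: its kernel is normal in `G`, so the
vectors fixed by it form a nonzero subrepresentation. -/
theorem injective_of_eigenvector [Finite G] [hK : K.Normal] [IsCyclic K] (hρ : ρ.IsIrreducible)
    (hfaith : Function.Injective ρ) (hv : v ≠ 0) (hφ : ∀ k : K, ρ k v = φ k • v) :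
    Function.Injective φ := by
  rw [injective_iff_map_eq_one]
  intro a ha
  let S : Subrepresentation ρ :=
    { toSubmodule := ⨅ k : φ.ker, LinearMap.eqLocus (ρ (k : K)) LinearMap.id
      apply_mem_toSubmodule := by
        intro g w hw
        simp only [Submodule.mem_iInf, LinearMap.mem_eqLocus, LinearMap.id_apply] at hw ⊢
        rintro ⟨k, hk⟩
        obtain ⟨q, hq⟩ := exists_conj_eq_pow K g⁻¹
        have h1 := hw ⟨k ^ (q + 1), pow_mem hk _⟩
        have h2 : (k : G) * g = g * ((k ^ (q + 1) : K) : G) := by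
          push_cast
          rw [← hq k k.2]; group
        change ρ k (ρ g w) = ρ g w
        rw [← Module.End.mul_apply, ← map_mul, h2, map_mul, Module.End.mul_apply, h1] }
  have hvS : v ∈ S.toSubmodule := by
    simp only [S, Submodule.mem_iInf, LinearMap.mem_eqLocus, LinearMap.id_apply]
    rintro ⟨k, hk⟩
    rw [hφ, MonoidHom.mem_ker.mp hk, one_smul]
  have hS : S = ⊤ := by
    refine (hρ.eq_bot_or_eq_top S).resolve_left fun h => hv ?_
    rw [h] at hvS
    exact (Submodule.mem_bot Ω).mp hvS
  have hall : ∀ w : V, ρ a w = w := fun w => by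
    have hw : w ∈ S.toSubmodule := by rw [hS]; exact Submodule.mem_top
    simp only [S, Submodule.mem_iInf, LinearMap.mem_eqLocus, LinearMap.id_apply] at hw
    exact hw ⟨a, ha⟩
  have : ρ a = ρ 1 := by rw [map_one]; exact LinearMap.ext hall
  exact Subtype.ext (hfaith this)

theorem apply_eigenvector_eq_smul_out (hφ : ∀ k : K, ρ k v = φ k • v) (g : G) :
    ∃ k : K, g = (g : G ⧸ K).out * k ∧ ρ g v = φ k • ρ (g : G ⧸ K).out v := by
  refine ⟨⟨(g : G ⧸ K).out⁻¹ * g, QuotientGroup.eq.mp (QuotientGroup.out_eq' _)⟩, by simp, ?_⟩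
  rw [← map_smul, ← hφ, ← Module.End.mul_apply, ← map_mul]
  simp

/-- Frobenius reciprocity for a linear character whose translates form a basis. -/
theorem nonempty_equiv_ind_of_basis {W : Type*} [AddCommGroup W] [Module Ω W]
    {lam : Representation Ω K W} (b : Module.Basis (G ⧸ K) Ω V)
    (f : Representation.IntertwiningMap lam (ρ.comp K.subtype))
    (w : W) (hw : ∀ w', ∃ c : Ω, c • w = w') (hb : ∀ q, b q = ρ q.out (f w))
    (hlam : ∀ k w, lam k w = φ k • w) : Nonempty (ρ.Equiv (lam.ind K.subtype)) := by
  have hφ : ∀ k : K, ρ k (f w) = φ k • f w := fun k => by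
    have := LinearMap.congr_fun (f.isIntertwining' k) w
    simp only [LinearMap.comp_apply, hlam, map_smul] at this
    exact this.symm
  let Φ : Representation.IndV K.subtype lam →ₗ[Ω] V :=
    Representation.Coinvariants.lift _
      (TensorProduct.lift <| (Finsupp.lift _ _ _ fun h => ρ h⁻¹ ∘ₗ f.toLinearMap) ∘ₗ
        (MonoidAlgebra.coeffLinearEquiv Ω).toLinearMap)
      fun k => by
        ext h x
        have h1 : f (lam k x) = ρ k (f x) := LinearMap.congr_fun (f.isIntertwining' k) x
        have h2 : ρ (k : G)⁻¹ (f (lam k x)) = f x := by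
          rw [h1, ← Module.End.mul_apply, ← map_mul, inv_mul_cancel, map_one, Module.End.one_apply]
        simp [h2]
  have hΦ : ∀ h x, Φ (Representation.IndV.mk K.subtype lam h x) = ρ h⁻¹ (f x) := fun h x => by
    simp [Φ]
  have hmk : ∀ (k : K) h x, Representation.IndV.mk K.subtype lam (k * h) (lam k x) =
      Representation.IndV.mk K.subtype lam h x := fun k h x => by
    have := Representation.Coinvariants.mk_self_apply
      (Representation.tprod ((Representation.leftRegular Ω G).comp K.subtype) lam) k
      (TensorProduct.tmul Ω (MonoidAlgebra.single h 1) x)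
    simpa using this
  let Ψ : V →ₗ[Ω] Representation.IndV K.subtype lam :=
    b.constr Ω fun q => Representation.IndV.mk K.subtype lam q.out⁻¹ w
  have hΨ : ∀ q, Ψ (b q) = Representation.IndV.mk K.subtype lam q.out⁻¹ w := fun q =>
    b.constr_basis Ω _ q
  have h1 : Φ ∘ₗ Ψ = LinearMap.id := b.ext fun q => by
    rw [LinearMap.comp_apply, hΨ, hΦ, inv_inv, hb, LinearMap.id_apply]
  have h2 : Ψ ∘ₗ Φ = LinearMap.id := by
    refine Representation.IndV.hom_ext _ _ fun h => LinearMap.ext fun x => ?_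
    obtain ⟨c, rfl⟩ := hw x
    obtain ⟨k, hk, hkv⟩ := apply_eigenvector_eq_smul_out hφ h⁻¹
    simp only [LinearMap.comp_apply, map_smul, LinearMap.id_apply]
    congr 1
    have h3 := hmk k⁻¹ (((h⁻¹ : G) : G ⧸ K).out)⁻¹ (lam k w)
    rw [← Module.End.mul_apply, ← map_mul, inv_mul_cancel, map_one, Module.End.one_apply] at h3
    have h4 : ((k⁻¹ : K) : G) * (((h⁻¹ : G) : G ⧸ K).out)⁻¹ = h := by
      rw [Subgroup.coe_inv, ← mul_inv_rev, ← hk, inv_inv]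
    rw [h4, hlam, map_smul] at h3
    have h5 := hΦ h w
    simp only [LinearMap.comp_apply] at h5 h3
    rw [h5, hkv, ← hb, map_smul, hΨ, h3]
    rfl
  let Θ : Representation.IntertwiningMap (lam.ind K.subtype) ρ :=
    ⟨Φ, fun g => Representation.IndV.hom_ext _ _ fun h => LinearMap.ext fun x => by
      have h3 := hΦ (h * g⁻¹) x
      rw [← Representation.ind_mk] at h3
      simp only [LinearMap.comp_apply] at h3 ⊢
      have h5 := hΦ h x
      simp only [LinearMap.comp_apply] at h5
      rw [h3, h5, mul_inv_rev, inv_inv, map_mul, Module.End.mul_apply]⟩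
  have hbij : Function.Bijective Θ :=
    ⟨Function.LeftInverse.injective (g := Ψ) fun x => LinearMap.congr_fun h2 x,
      Function.RightInverse.surjective (g := Ψ) fun x => LinearMap.congr_fun h1 x⟩
  exact ⟨(Representation.IntertwiningMap.ofBijective Θ hbij).symm⟩

variable [hK : K.Normal]

theorem apply_apply_eigenvector (hφ : ∀ k : K, ρ k v = φ k • v) (k : K) (g : G) :
    ρ k (ρ g v) = φ ⟨g⁻¹ * k * g, by simpa using hK.conj_mem k k.2 g⁻¹⟩ • ρ g v := by
  rw [← map_smul, ← hφ, ← Module.End.mul_apply, ← Module.End.mul_apply, ← map_mul, ← map_mul]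
  congr 2
  group

/-- The translates of an eigenvector with faithful eigencharacter on a self-centralizing cyclic
normal subgroup `K` along `G ⧸ K` form a basis of an irreducible representation. -/
theorem exists_basis_translates [IsCyclic K] (hρ : ρ.IsIrreducible)
    (hcent : ∀ g : G, (∀ k ∈ K, g * k * g⁻¹ = k) → g ∈ K) (hv : v ≠ 0)
    (hφ : ∀ k : K, ρ k v = φ k • v) (hinj : Function.Injective φ) :
    ∃ b : Module.Basis (G ⧸ K) Ω V, ∀ q, b q = ρ q.out v := by
  obtain ⟨k0, hk0⟩ := IsCyclic.exists_generator (α := K)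
  have hli : LinearIndependent Ω fun q : G ⧸ K => ρ q.out v := by
    refine Module.End.eigenvectors_linearIndependent' (ρ k0) (fun q : G ⧸ K =>
      φ ⟨q.out⁻¹ * k0 * q.out, by simpa using hK.conj_mem k0 k0.2 q.out⁻¹⟩) ?_ _ fun q => ?_
    · intro q q' h
      have h1 : q.out⁻¹ * k0 * q.out = q'.out⁻¹ * k0 * q'.out := congrArg Subtype.val (hinj h)
      have h2 : q.out⁻¹ * q'.out ∈ K := by
        have h3 : q'.out * q.out⁻¹ ∈ K := by
          refine hcent _ fun k hk => ?_
          obtain ⟨j, hj⟩ := hk0 ⟨k, hk⟩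
          have hj' : k = (k0 : G) ^ j := (congrArg Subtype.val hj).symm
          have hc : (q'.out * q.out⁻¹) * k0 * (q'.out * q.out⁻¹)⁻¹ = k0 := by
            calc (q'.out * q.out⁻¹) * k0 * (q'.out * q.out⁻¹)⁻¹
                = q'.out * (q.out⁻¹ * k0 * q.out) * q'.out⁻¹ := by group
              _ = k0 := by rw [h1]; group
          rw [hj', ← conj_zpow, hc]
        simpa [mul_assoc] using hK.conj_mem _ h3 q.out⁻¹
      rw [← QuotientGroup.out_eq' q, ← QuotientGroup.out_eq' q']
      exact QuotientGroup.eq.mpr h2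
    · refine Module.End.hasEigenvector_iff.mpr ⟨Module.End.mem_eigenspace_iff.mpr
        (apply_apply_eigenvector hφ k0 q.out), fun h => hv ?_⟩
      have h1 := congrArg (ρ q.out⁻¹) h
      rwa [← Module.End.mul_apply, ← map_mul, inv_mul_cancel, map_one, map_zero] at h1
  have htop : ⊤ ≤ Submodule.span Ω (Set.range fun q : G ⧸ K => ρ q.out v) := by
    let S : Subrepresentation ρ :=
      { toSubmodule := Submodule.span Ω (Set.range fun q : G ⧸ K => ρ q.out v)
        apply_mem_toSubmodule := by
          intro g w hw
          induction hw using Submodule.span_induction with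
          | mem w hw =>
            obtain ⟨q, rfl⟩ := hw
            obtain ⟨k, -, hk⟩ := apply_eigenvector_eq_smul_out hφ (g * q.out)
            change ρ g (ρ q.out v) ∈ _
            rw [← Module.End.mul_apply, ← map_mul, hk]
            exact Submodule.smul_mem _ _ (Submodule.subset_span ⟨_, rfl⟩)
          | zero => simp
          | add x y _ _ hx hy => rw [map_add]; exact Submodule.add_mem _ hx hy
          | smul c x _ hx => rw [map_smul]; exact Submodule.smul_mem _ _ hx }
    have hS : S = ⊤ := by
      refine (hρ.eq_bot_or_eq_top S).resolve_left fun h => hli.ne_zero (1 : G ⧸ K) ?_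
      have h1 : ρ (1 : G ⧸ K).out v ∈ S.toSubmodule := Submodule.subset_span ⟨1, rfl⟩
      rw [h] at h1
      exact (Submodule.mem_bot Ω).mp h1
    exact (congrArg Subrepresentation.toSubmodule hS).ge
  exact ⟨Module.Basis.mk hli htop, fun q => by simp⟩

variable [Fintype (G ⧸ K)] (b : Module.Basis (G ⧸ K) Ω V)

theorem character_eq_sum_conj_of_basis (hb : ∀ q, b q = ρ q.out v)
    (hφ : ∀ k : K, ρ k v = φ k • v) (k : K) : ρ.character k =
      ∑ q : G ⧸ K, φ ⟨q.out⁻¹ * k * q.out, by simpa using hK.conj_mem k k.2 q.out⁻¹⟩ := by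
  classical
  rw [Representation.character, LinearMap.trace_eq_matrix_trace Ω b, Matrix.trace]
  refine Finset.sum_congr rfl fun q _ => ?_
  rw [Matrix.diag_apply, LinearMap.toMatrix_apply, hb, apply_apply_eigenvector hφ, ← hb]
  simp

theorem character_eq_zero_of_basis (hb : ∀ q, b q = ρ q.out v)
    (hφ : ∀ k : K, ρ k v = φ k • v) {g : G} (hg : g ∉ K) : ρ.character g = 0 := by
  classical
  rw [Representation.character, LinearMap.trace_eq_matrix_trace Ω b, Matrix.trace]
  refine Finset.sum_eq_zero fun q _ => ?_
  obtain ⟨k, -, hk⟩ := apply_eigenvector_eq_smul_out hφ (g * q.out)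
  rw [Matrix.diag_apply, LinearMap.toMatrix_apply, hb, ← Module.End.mul_apply, ← map_mul, hk, ← hb]
  have hne : ((g * q.out : G) : G ⧸ K) ≠ q := by
    intro h
    rw [QuotientGroup.mk_mul, QuotientGroup.out_eq', mul_eq_right] at h
    exact hg ((QuotientGroup.eq_one_iff g).mp h)
  rw [map_smul, b.repr_self, Finsupp.smul_apply, Finsupp.single_eq_of_ne hne.symm, smul_zero]

end

/-! ### Blocks of the group algebra with split image -/

/-- The kernel of a surjection from a semisimple ring is generated by a central idempotent. -/
theorem IsSemisimpleRing.exists_central_idempotent {R A : Type*} [Ring R] [IsSemisimpleRing R]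
    [Ring A] (f : R →+* A) :
    ∃ e ∈ Subring.center R, IsIdempotentElem e ∧ f e = 1 ∧ ∀ r, f r = 0 → r * e = 0 := by
  obtain ⟨d, hd, hker⟩ := IsSemisimpleRing.ideal_eq_span_idempotent (RingHom.ker f)
  have hmem : ∀ r, f r = 0 ↔ r * d = r := fun r => by
    rw [← RingHom.mem_ker, hker, Ideal.mem_span_singleton']
    exact ⟨fun ⟨a, ha⟩ => by rw [← ha, mul_assoc, hd.eq], fun h => ⟨r, h⟩⟩
  have hfd : f d = 0 := (hmem d).mpr hd.eq
  -- `d * r - d * r * d` vanishes, and so does `x = r * d - d * r * d`, since it generates a left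
  -- ideal of square zero
  have hdr : ∀ r, d * r = d * r * d := fun r => ((hmem _).mp (by rw [map_mul, hfd, zero_mul])).symm
  have hrd : ∀ r, r * d = d * r * d := fun r => by
    rw [← sub_eq_zero]
    set x := r * d - d * r * d with hx
    have hfx : f x = 0 := by simp [hx, hfd]
    have hdx : d * x = 0 := by
      rw [hx, mul_sub, ← mul_assoc d (d * r) d, ← mul_assoc d d r, hd.eq, ← mul_assoc, sub_self]
    obtain ⟨c, hc, hcx⟩ := IsSemisimpleRing.ideal_eq_span_idempotent (Ideal.span {x})
    have hcmem : c ∈ Ideal.span {x} := hcx ▸ Ideal.mem_span_singleton_self c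
    have hxmem : x ∈ Ideal.span {c} := hcx ▸ Ideal.mem_span_singleton_self x
    obtain ⟨a, ha⟩ := Ideal.mem_span_singleton'.mp hcmem
    obtain ⟨a', ha'⟩ := Ideal.mem_span_singleton'.mp hxmem
    have hxx : ∀ s, x * s * x = 0 := fun s => by
      have : x * s * d = x * s := (hmem _).mp (by rw [map_mul, hfx, zero_mul])
      rw [← this, mul_assoc, hdx, mul_zero]
    have hc0 : c = 0 := by
      rw [← hc.eq, ← ha, mul_assoc, ← mul_assoc x a x, hxx, mul_zero]
    rw [← ha', hc0, mul_zero]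
  refine ⟨1 - d, ?_, hd.one_sub, by simp [hfd], fun r hr => ?_⟩
  · rw [Subring.mem_center_iff]
    intro r
    rw [mul_sub, sub_mul, mul_one, one_mul, hdr r, hrd r]
  · rw [mul_sub, mul_one, (hmem r).mp hr, sub_self]

theorem IsPrimitiveCentralIdempotent.mul_eq_zero_or_eq {R : Type*} [Ring R] {e f : R}
    (he : IsPrimitiveCentralIdempotent e) (hf : IsPrimitiveCentralIdempotent f) :
    e * f = 0 ∨ e = f := by
  have key : ∀ {a b : R}, IsPrimitiveCentralIdempotent a → IsPrimitiveCentralIdempotent b →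
      a * b = 0 ∨ a = a * b := fun {a b} ha hb => by
    have hba : b * a = a * b := Subring.mem_center_iff.mp ha.mem_center b
    have hab : IsIdempotentElem (a * b) := by
      rw [IsIdempotentElem, mul_assoc, ← mul_assoc b a b, hba, mul_assoc a b b, hb.idem.eq,
        ← mul_assoc, ha.idem.eq]
    have h1 : a * (a * b) = a * b := by rw [← mul_assoc, ha.idem.eq]
    have h2 : a * b * a = a * b := by rw [mul_assoc, hba, h1]
    have hac := Subring.mul_mem _ ha.mem_center hb.mem_center
    rcases ha.primitive (a * b) (a - a * b) hac (Subring.sub_mem _ ha.mem_center hac) hab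
      (by rw [IsIdempotentElem, sub_mul, mul_sub, mul_sub, ha.idem.eq, h1, h2, hab.eq]; abel)
      (by rw [mul_sub, h2, hab.eq, sub_self]) (by abel) with h | h
    · exact Or.inl h
    · exact Or.inr (sub_eq_zero.mp h)
  have hfe : f * e = e * f := Subring.mem_center_iff.mp he.mem_center f
  rcases key he hf with h | h
  · exact Or.inl h
  · rcases key hf he with h' | h'
    · exact Or.inl (hfe ▸ h')
    · exact Or.inr (h.trans (hfe.symm.trans h'.symm))

/-- If an `F`-algebra homomorphism from `F[G]` onto the full endomorphism algebra of an `E`-vector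
space `M` has trace `χ`, then `χ` belongs to a unique block of `F[G]`, and this block is isomorphic
to `End_E M`. -/
theorem block_of_surjective {F E Ω G M : Type*} [Field F] [CharZero F] [Field E] [Field Ω]
    [Algebra F E] [Algebra F Ω] [Algebra E Ω] [IsScalarTower F E Ω] [Group G] [Finite G]
    [AddCommGroup M] [Module E M] [Module F M] [IsScalarTower F E M] [FiniteDimensional E M]
    [Nontrivial M] {χ : G → Ω} (Θ : F[G] →ₐ[F] Module.End E M) (hΘ : Function.Surjective Θ)
    (hχ : ∀ g, χ g = algebraMap E Ω (LinearMap.trace E M (Θ (MonoidAlgebra.single g 1)))) :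
    (∃! e : F[G], IsBlockIdempotent χ e) ∧
      ∀ (e : F[G]) (he : IsBlockIdempotent χ e),
        Nonempty (WedderburnComponent he ≃ₐ[F] Module.End E M) := by
  have : CharZero E := charZero_of_injective_algebraMap (algebraMap F E).injective
  have heval : ∀ a : F[G], charEval χ a = algebraMap E Ω (LinearMap.trace E M (Θ a)) := by
    intro a
    induction a using MonoidAlgebra.induction_linear with
    | zero => simp [charEval]
    | add a b ha hb =>
      rw [map_add, map_add, map_add, ← ha, ← hb, charEval, charEval, charEval]
      exact Finsupp.sum_add_index' (fun _ => zero_smul _ _) fun _ _ _ => add_smul _ _ _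
    | single g c =>
      have h1 : MonoidAlgebra.single g c = c • (MonoidAlgebra.single g (1 : F) : F[G]) := by simp
      have h2 : charEval χ (MonoidAlgebra.single g c : F[G]) = c • χ g :=
        Finsupp.sum_single_index (zero_smul _ _)
      rw [h2, h1, map_smul, hχ, ← algebraMap_smul E c (Θ _), map_smul, smul_eq_mul, map_mul,
        ← IsScalarTower.algebraMap_apply, Algebra.smul_def]
  obtain ⟨e, hec, hei, he1, hker⟩ := IsSemisimpleRing.exists_central_idempotent Θ.toRingHom
  replace he1 : Θ e = 1 := he1
  replace hker : ∀ r, Θ r = 0 → r * e = 0 := hker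
  have hcentral : ∀ f ∈ Subring.center F[G], IsIdempotentElem f → Θ f = 0 ∨ Θ f = 1 := by
    intro f hf hfi
    have h1 : Θ f ∈ Subalgebra.center E (Module.End E M) := by
      rw [Subalgebra.mem_center_iff]
      intro b
      obtain ⟨a, rfl⟩ := hΘ b
      rw [← map_mul, ← map_mul, Subring.mem_center_iff.mp hf a]
    obtain ⟨c, hc⟩ := Algebra.mem_bot.mp (Algebra.IsCentral.out h1)
    have h2 : c * c = c := by
      apply FaithfulSMul.algebraMap_injective E (Module.End E M)
      rw [map_mul, hc, ← map_mul, hfi.eq]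
    rcases IsIdempotentElem.iff_eq_zero_or_one.mp h2 with rfl | rfl
    · exact Or.inl (by rw [← hc, map_zero])
    · exact Or.inr (by rw [← hc, map_one])
  have hprim : IsPrimitiveCentralIdempotent e := by
    refine ⟨hec, hei, fun h => ?_, fun f g hf hg hfi hgi hfg hsum => ?_⟩
    · rw [h, map_zero] at he1
      exact zero_ne_one he1
    · have hgf : g * f = 0 := by rw [← hfg]; exact Subring.mem_center_iff.mp hf g
      have hfe : f * e = f := by rw [hsum, mul_add, hfi.eq, hfg, add_zero]
      have hge : g * e = g := by rw [hsum, mul_add, hgi.eq, hgf, zero_add]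
      rcases hcentral f hf hfi with h | h
      · exact Or.inl (by rw [← hfe, hker f h])
      · refine Or.inr ?_
        have h2 : Θ g = 0 := by rw [← one_mul (Θ g), ← h, ← map_mul, hfg, map_zero]
        rw [← hge, hker g h2]
  have hblock : IsBlockIdempotent χ e := by
    refine ⟨hprim, ?_⟩
    rw [heval, he1, LinearMap.trace_one]
    rw [ne_eq, map_eq_zero]
    exact Nat.cast_ne_zero.mpr (Module.finrank_pos (R := E) (M := M)).ne'
  have huniq : ∀ f, IsBlockIdempotent χ f → f = e := by
    intro f hf
    refine (hf.toIsPrimitiveCentralIdempotent.mul_eq_zero_or_eq hprim).resolve_left fun h => ?_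
    apply hf.charEval_ne_zero
    rw [heval, ← mul_one (Θ f), ← he1, ← map_mul, h, map_zero, map_zero, map_zero]
  refine ⟨⟨e, hblock, huniq⟩, fun f hf => ?_⟩
  obtain rfl := huniq f hf
  let Ψ : WedderburnComponent hf →ₐ[F] Module.End E M :=
    { toFun := fun a => Θ a.1
      map_one' := he1
      map_mul' := fun a b => map_mul Θ a.1 b.1
      map_zero' := map_zero Θ
      map_add' := fun a b => map_add Θ a.1 b.1
      commutes' := fun c => by
        change Θ (c • f) = _
        rw [map_smul, he1, Algebra.algebraMap_eq_smul_one] }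
  refine ⟨AlgEquiv.ofBijective Ψ ⟨?_, fun b => ?_⟩⟩
  · rw [injective_iff_map_eq_zero]
    intro a ha
    have h1 := ((Subsemigroup.mem_corner_iff hf.idem).mp a.2).2
    exact Subtype.ext (by rw [← h1]; exact hker _ ha)
  · obtain ⟨a, rfl⟩ := hΘ b
    refine ⟨⟨f * a * f, a, rfl⟩, ?_⟩
    change Θ (f * a * f) = Θ a
    rw [map_mul, map_mul, he1, one_mul, mul_one]

/-! ### Semilinear actions on a Galois extension -/

section

variable {E L : Type*} [Field E] [Field L] [Algebra E L]

/-- The trace of a Galois automorphism `σ ≠ 1` followed by multiplication by `a` vanishes. It is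
additive in `a` and invariant under conjugation by the multiplication by `x`, so it vanishes
whenever `a = b * (σ x - x)`. -/
theorem trace_mulLeft_comp_algEquiv_eq_zero {σ : Gal(L/E)} (hσ : σ ≠ 1) (a : L) :
    LinearMap.trace E L (LinearMap.mulLeft E a ∘ₗ σ.toLinearMap) = 0 := by
  obtain ⟨x, hx⟩ : ∃ x, σ x ≠ x := by
    by_contra! h
    exact hσ (AlgEquiv.ext h)
  have hx' : σ x - x ≠ 0 := sub_ne_zero.mpr hx
  set b := a / (σ x - x) with hb
  have hab : a = b * σ x - b * x := by rw [hb]; field_simp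
  have h1 := LinearMap.trace_mul_comm E (LinearMap.mulLeft E b ∘ₗ σ.toLinearMap)
    (LinearMap.mulLeft E x)
  have h2 : LinearMap.mulLeft E a ∘ₗ σ.toLinearMap =
      (LinearMap.mulLeft E b ∘ₗ σ.toLinearMap) * LinearMap.mulLeft E x -
        LinearMap.mulLeft E x * (LinearMap.mulLeft E b ∘ₗ σ.toLinearMap) := by
    ext z
    simp [hab]
    ring
  rw [h2, map_sub, h1, sub_self]

/-- The Galois automorphisms span `End_E L` over `L`: they are independent by Dedekind's lemma, and
there are `[L : E]` of them. -/
theorem span_range_toLinearMap_eq_top [FiniteDimensional E L] [IsGalois E L] :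
    Submodule.span L (Set.range fun σ : Gal(L/E) => σ.toLinearMap) = ⊤ := by
  have hli : LinearIndependent L fun σ : Gal(L/E) => σ.toLinearMap :=
    (linearIndependent_toLinearMap E L L).comp
      (fun σ : Gal(L/E) => (σ : L →ₐ[E] L)) fun _ _ h => AlgEquiv.coe_toAlgHom_injective h
  apply hli.span_eq_top_of_card_eq_finrank
  rw [Module.finrank_linearMap_self, ← IsGalois.card_aut_eq_finrank, Nat.card_eq_fintype_card]

end

/-- Let `G` act `E`-linearly on a finite Galois extension `L` of `E` by `g ↦ c g • τ g`, where
`τ : G → Gal(L/E)` is surjective and `c` is a `1`-cocycle whose values on `ker τ` span `L` over `F`.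
If `χ` is the trace of this action, then its block of `F[G]` is a full matrix algebra over `E`. -/
theorem block_of_cocycle {F E L Ω G : Type*} [Field F] [CharZero F] [Field E] [Field L] [Field Ω]
    [Algebra F E] [Algebra F L] [Algebra E L] [IsScalarTower F E L]
    [Algebra F Ω] [Algebra E Ω] [IsScalarTower F E Ω] [Group G] [Finite G]
    [FiniteDimensional E L] [IsGalois E L] {τ : G →* Gal(L/E)} (hτ : Function.Surjective τ)
    {c : G → L} (hc1 : c 1 = 1) (hcmul : ∀ g h, c (g * h) = c g * τ g (c h))
    (hspan : Submodule.span F (c '' τ.ker) = ⊤) {χ : G → Ω} (hχ0 : ∀ g, τ g ≠ 1 → χ g = 0)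
    (hχ1 : ∀ g, τ g = 1 → χ g = algebraMap E Ω (Algebra.trace E L (c g)))
    {N : ℕ} (hN : Nat.card Gal(L/E) = N) :
    (∃! e : F[G], IsBlockIdempotent χ e) ∧
      ∀ (e : F[G]) (he : IsBlockIdempotent χ e),
        Nonempty (WedderburnComponent he ≃ₐ[F] Matrix (Fin N) (Fin N) E) := by
  let θ : G →* Module.End E L :=
    { toFun := fun g => LinearMap.mulLeft E (c g) ∘ₗ (τ g).toLinearMap
      map_one' := by ext; simp [hc1]
      map_mul' := fun g h => by ext; simp [hcmul] }
  have hθ : ∀ g, θ g = LinearMap.mulLeft E (c g) ∘ₗ (τ g).toLinearMap := fun _ => rfl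
  let Θ : F[G] →ₐ[F] Module.End E L := MonoidAlgebra.lift F (Module.End E L) G θ
  have hΘ : ∀ g, Θ (MonoidAlgebra.single g 1) = θ g := fun g => by simp [Θ]
  have hmul : ∀ x : L, LinearMap.mulLeft E x ∈ Θ.range := by
    intro x
    have hx : x ∈ Submodule.span F (c '' τ.ker) := hspan ▸ Submodule.mem_top
    induction hx using Submodule.span_induction with
    | mem x hx =>
      obtain ⟨g, hg, rfl⟩ := hx
      refine ⟨MonoidAlgebra.single g 1, (hΘ g).trans ?_⟩
      rw [hθ, MonoidHom.mem_ker.mp hg]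
      ext; simp
    | zero => simp
    | add x y _ _ hx hy =>
      convert Subalgebra.add_mem _ hx hy using 1
      ext; simp [add_mul]
    | smul a x _ hx =>
      convert Subalgebra.smul_mem _ hx a using 1
      ext; simp
  have hc0 : ∀ g, c g ≠ 0 := fun g h => by
    have := hcmul g g⁻¹
    rw [mul_inv_cancel, hc1, h, zero_mul] at this
    exact one_ne_zero this
  have hsurj : Function.Surjective Θ := by
    intro f
    have hf : f ∈ Submodule.span L (Set.range fun σ : Gal(L/E) => σ.toLinearMap) :=
      span_range_toLinearMap_eq_top (E := E) (L := L) ▸ Submodule.mem_top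
    change f ∈ Θ.range
    induction hf using Submodule.span_induction with
    | mem f hf =>
      obtain ⟨σ, rfl⟩ := hf
      obtain ⟨g, rfl⟩ := hτ σ
      have h1 : (τ g).toLinearMap = LinearMap.mulLeft E (c g)⁻¹ * θ g := by
        ext; simp [hθ, hc0 g]
      simp only [h1, ← hΘ g]
      exact Subalgebra.mul_mem _ (hmul _) ⟨_, rfl⟩
    | zero => exact Subalgebra.zero_mem _
    | add f g _ _ hf hg => exact Subalgebra.add_mem _ hf hg
    | smul a f _ hf =>
      have h1 : a • f = LinearMap.mulLeft E a * f := by ext; simp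
      rw [h1]
      exact Subalgebra.mul_mem _ (hmul a) hf
  have htr : ∀ g, χ g = algebraMap E Ω (LinearMap.trace E L (Θ (MonoidAlgebra.single g 1))) := by
    intro g
    rw [hΘ, hθ]
    by_cases hg : τ g = 1
    · rw [hχ1 g hg, hg, Algebra.trace_apply]
      rfl
    · rw [hχ0 g hg, trace_mulLeft_comp_algEquiv_eq_zero hg, map_zero]
  obtain ⟨h1, h2⟩ := block_of_surjective Θ hsurj htr
  refine ⟨h1, fun e he => ?_⟩
  obtain ⟨ψ⟩ := h2 e he
  have hfin : Module.finrank E L = N := by rw [← hN, IsGalois.card_aut_eq_finrank]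
  exact ⟨ψ.trans ((algEquivMatrix (Module.finBasisOfFinrankEq E L hfin)).restrictScalars F)⟩

/-! ### Automorphisms over an intermediate field -/

namespace IntermediateField

variable {F Ω : Type*} [Field F] [Field Ω] [Algebra F Ω] {E L : IntermediateField F Ω}

/-- The identity map between `L` as an extension of `E` and `L` as an extension of `F`. -/
def extendScalarsEquiv (h : E ≤ L) : extendScalars h ≃ₐ[F] L where
  toFun x := ⟨x.1, x.2⟩
  invFun x := ⟨x.1, x.2⟩
  map_mul' _ _ := rfl
  map_add' _ _ := rfl
  commutes' _ := rfl

/-- The inclusion of `Gal(L/E)` into `Gal(L/F)`. -/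
def galRestrict (h : E ≤ L) : Gal(extendScalars h/E) →* Gal(L/F) :=
  (AlgEquiv.autCongr (extendScalarsEquiv h)).toMonoidHom.comp (AlgEquiv.restrictScalarsHom F)

theorem coe_galRestrict_apply (h : E ≤ L) (σ : Gal(extendScalars h/E)) (x : L) :
    (galRestrict h σ x : Ω) = σ ⟨x.1, x.2⟩ := rfl

theorem galRestrict_injective (h : E ≤ L) : Function.Injective (galRestrict h) := by
  intro σ τ hστ
  ext x
  have := congrArg (fun f : Gal(L/F) => (f ⟨x.1, x.2⟩ : Ω)) hστ
  exact this

theorem mem_lift_fixedField_zpowers {τ : Gal(L/F)} {x : Ω} (hx : x ∈ L) :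
    x ∈ lift (fixedField (Subgroup.zpowers τ)) ↔ (τ ⟨x, hx⟩ : Ω) = x := by
  refine (mem_lift (⟨x, hx⟩ : L)).trans ?_
  rw [mem_fixedField_iff]
  constructor
  · intro h
    exact congrArg Subtype.val (h τ (Subgroup.mem_zpowers τ))
  · intro h f hf
    have hle : Subgroup.zpowers τ ≤ MulAction.stabilizer Gal(L/F) (⟨x, hx⟩ : L) := by
      rw [Subgroup.zpowers_le]
      exact Subtype.ext h
    exact hle hf

theorem le_lift_fixedField_galRestrict (h : E ≤ L) (σ : Gal(extendScalars h/E)) :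
    E ≤ lift (fixedField (Subgroup.zpowers (galRestrict h σ))) := fun x hx => by
  rw [mem_lift_fixedField_zpowers (h hx), coe_galRestrict_apply]
  exact congrArg Subtype.val (σ.commutes ⟨x, hx⟩)

theorem exists_galRestrict_eq (h : E ≤ L) {τ : Gal(L/F)}
    (hτ : E ≤ lift (fixedField (Subgroup.zpowers τ))) :
    ∃ σ : Gal(extendScalars h/E), galRestrict h σ = τ := by
  let f := AlgEquiv.autCongr (extendScalarsEquiv h).symm τ
  refine ⟨AlgEquiv.ofRingEquiv (f := (f : extendScalars h ≃+* extendScalars h)) fun x => ?_, ?_⟩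
  · exact Subtype.ext ((mem_lift_fixedField_zpowers (h x.2)).mp (hτ x.2))
  · ext x
    rfl

variable [Algebra.IsAlgebraic F Ω] {ζ : Ω} {N : ℕ} [NeZero N]

theorem isCyclotomicExtension_of_eq_adjoin (hζ : IsPrimitiveRoot ζ N) (hL : L = F⟮ζ⟯) :
    IsCyclotomicExtension {N} F L := by
  subst hL
  exact hζ.intermediateField_adjoin_isCyclotomicExtension F

theorem isCyclotomicExtension_extendScalars (h : E ≤ L) (hζ : IsPrimitiveRoot ζ N)
    (hL : L = F⟮ζ⟯) : IsCyclotomicExtension {N} E (extendScalars h) := by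
  subst hL
  rw [extendScalars_adjoin]
  have : Algebra.IsAlgebraic E Ω := Algebra.IsAlgebraic.tower_top (K := F) E
  exact hζ.intermediateField_adjoin_isCyclotomicExtension E

/-- If `E` contains `ζ ^ N` and has degree `N` under `F(ζ)`, then `E = F(ζ ^ N)`, since `ζ` is a
root of `X ^ N - ζ ^ N`. -/
theorem eq_adjoin_pow_of_finrank_eq (h : E ≤ L) (hL : L = F⟮ζ⟯) (hmem : ζ ^ N ∈ E)
    (hfin : Module.finrank E (extendScalars h) = N) : E = F⟮ζ ^ N⟯ := by
  have hζL : ζ ∈ L := hL ▸ mem_adjoin_simple_self F ζ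
  have hE1 : F⟮ζ ^ N⟯ ≤ E := adjoin_simple_le_iff.mpr hmem
  have h1 : F⟮ζ ^ N⟯ ≤ L := hE1.trans h
  have hfd : FiniteDimensional F L := by
    subst hL
    exact adjoin.finiteDimensional (Algebra.IsIntegral.isIntegral ζ)
  have hfdE : FiniteDimensional F E :=
    FiniteDimensional.of_injective (inclusion h).toLinearMap (inclusion_injective h)
  have hdeg : Module.finrank F⟮ζ ^ N⟯ (extendScalars h1) ≤ N := by
    subst hL
    rw [extendScalars_adjoin]
    have halg : Algebra.IsAlgebraic F⟮ζ ^ N⟯ Ω := Algebra.IsAlgebraic.tower_top (K := F) _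
    rw [adjoin.finrank (Algebra.IsIntegral.isIntegral ζ)]
    have hp : (Polynomial.X ^ N - Polynomial.C (AdjoinSimple.gen F (ζ ^ N))).natDegree = N :=
      Polynomial.natDegree_X_pow_sub_C
    calc _ ≤ (Polynomial.X ^ N - Polynomial.C (AdjoinSimple.gen F (ζ ^ N))).natDegree :=
          Polynomial.natDegree_le_natDegree (minpoly.min _ _
            (Polynomial.monic_X_pow_sub_C _ (NeZero.ne N)) (by simp))
      _ = N := hp
  have e1 := (extendScalarsEquiv h1).toLinearEquiv.finrank_eq
  have e2 := (extendScalarsEquiv h).toLinearEquiv.finrank_eq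
  rw [← Module.finrank_mul_finrank F F⟮ζ ^ N⟯] at e1
  rw [← Module.finrank_mul_finrank F E, hfin] at e2
  refine (eq_of_le_of_finrank_le hE1 ?_).symm
  refine Nat.le_of_mul_le_mul_right ?_ (Nat.pos_of_ne_zero (NeZero.ne N))
  rw [e2, ← e1]
  exact Nat.mul_le_mul_left _ hdeg

end IntermediateField

theorem isPrimitiveRoot_of_forall_mem_zpowers {Ω H : Type*} [Field Ω] [Group H] {φ : H →* Ω}
    (hφ : Function.Injective φ) {a : H} (ha : ∀ x, x ∈ Subgroup.zpowers a) :
    IsPrimitiveRoot (φ a) (Nat.card H) := by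
  rw [← orderOf_eq_card_of_forall_mem_zpowers ha, ← orderOf_injective φ hφ a]
  exact IsPrimitiveRoot.orderOf _

/-- The field generated by a faithful linear character of a cyclic group of order `N` is generated
by the `N`-th roots of unity. -/
theorem charField_eq_adjoin_of_injective {F Ω H : Type*} [Field F] [Field Ω] [Algebra F Ω] [Group H]
    [Finite H] [IsCyclic H] {φ : H →* Ω} (hφ : Function.Injective φ) {ζ : Ω}
    (hζ : IsPrimitiveRoot ζ (Nat.card H)) : charField F φ = F⟮ζ⟯ := by
  have hpos : Nat.card H ≠ 0 := Nat.card_pos.ne'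
  have : NeZero (Nat.card H) := ⟨hpos⟩
  obtain ⟨h0, hh0⟩ := IsCyclic.exists_generator (α := H)
  have hprim : IsPrimitiveRoot (φ h0) (Nat.card H) :=
    isPrimitiveRoot_of_forall_mem_zpowers hφ hh0
  apply le_antisymm
  · refine IntermediateField.adjoin_le_iff.mpr ?_
    rintro _ ⟨h, rfl⟩
    have h1 : φ h ^ Nat.card H = 1 := by rw [← map_pow, pow_card_eq_one', map_one]
    obtain ⟨i, -, hi⟩ := hζ.eq_pow_of_pow_eq_one h1
    rw [SetLike.mem_coe, ← hi]
    exact pow_mem (IntermediateField.mem_adjoin_simple_self F ζ) i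
  · rw [IntermediateField.adjoin_simple_le_iff]
    obtain ⟨i, -, hi⟩ := hprim.eq_pow_of_pow_eq_one hζ.pow_eq_one
    rw [← hi]
    exact pow_mem (mem_charField F φ h0) i

/-! ### The cyclotomic action on `2`-power roots of unity over a field containing `√-1` -/

theorem IsPrimitiveRoot.pow_two_pow_sub_two_sq_eq_neg_one {A : Type*} [CommRing A] [IsDomain A]
    {ζ : A} {n : ℕ} (hζ : IsPrimitiveRoot ζ (2 ^ n)) (hn : 2 ≤ n) :
    (ζ ^ 2 ^ (n - 2)) ^ 2 = -1 := by
  rw [← pow_mul, ← pow_succ]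
  refine IsPrimitiveRoot.eq_neg_one_of_two_right (hζ.pow (by positivity) ?_)
  rw [← pow_succ]
  congr 1
  omega

/-- An automorphism fixing a square root of `-1` raises `2`-power roots of unity to a power that is
congruent to `1` modulo `4`. -/
theorem four_dvd_of_apply_eq_pow_succ {F A : Type*} [Field F] [CommRing A] [IsDomain A]
    [Algebra F A] (hi : ∃ i : F, i ^ 2 = -1) {n : ℕ} (hn : 2 ≤ n) {ζ : A}
    (hζ : IsPrimitiveRoot ζ (2 ^ n)) (σ : A ≃ₐ[F] A) {q : ℕ} (hq : σ ζ = ζ ^ (q + 1)) : 4 ∣ q := by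
  obtain ⟨i, hi⟩ := hi
  set j := ζ ^ 2 ^ (n - 2) with hj
  have hjF : ∃ x : F, algebraMap F A x = j := by
    have h1 : j ^ 2 = algebraMap F A i ^ 2 := by
      rw [hζ.pow_two_pow_sub_two_sq_eq_neg_one hn, ← map_pow, hi, map_neg, map_one]
    rcases sq_eq_sq_iff_eq_or_eq_neg.mp h1 with h | h
    · exact ⟨i, h.symm⟩
    · exact ⟨-i, by rw [map_neg, h]⟩
  obtain ⟨x, hx⟩ := hjF
  have hσj : σ j = j := by rw [← hx, σ.commutes]
  have h2 : j ^ q = 1 := by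
    have hj0 : j ≠ 0 := pow_ne_zero _ (hζ.ne_zero (by positivity))
    have h3 : j ^ q * j = j := by
      rw [← pow_succ]
      conv_rhs => rw [← hσj, hj, map_pow, hq]
      rw [hj, ← pow_mul, ← pow_mul, mul_comm]
    exact mul_right_cancel₀ hj0 (h3.trans (one_mul j).symm)
  rw [hj, ← pow_mul, hζ.pow_eq_one_iff_dvd] at h2
  have h4 : 2 ^ n = 2 ^ (n - 2) * 4 := by
    rw [show (4 : ℕ) = 2 ^ 2 by norm_num, ← pow_add]
    congr 1
    omega
  rw [h4] at h2
  exact Nat.dvd_of_mul_dvd_mul_left (by positivity) h2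

/-- The units of `ℤ/2ⁿ` that are congruent to `1` modulo `4` form a cyclic group, generated
by `5`. -/
theorem isCyclic_of_injective_units_two_pow {H : Type*} [Group H] {n : ℕ}
    (f : H →* (ZMod (2 ^ n))ˣ) (hf : Function.Injective f)
    (h4 : 2 ≤ n → ∀ h, (f h : ZMod (2 ^ n)).val % 4 = 1) : IsCyclic H := by
  rcases Nat.lt_or_ge n 2 with hn | hn
  · have : Subsingleton (ZMod (2 ^ n))ˣ := by
      interval_cases n
      · exact inferInstanceAs (Subsingleton (ZMod 1)ˣ)
      · exact inferInstanceAs (Subsingleton (ZMod 2)ˣ)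
    exact isCyclic_of_injective f hf
  obtain ⟨m, rfl⟩ := Nat.exists_eq_add_of_le' hn
  have h5 : Nat.Coprime 5 (2 ^ (m + 2)) := Nat.Coprime.pow_right _ (by norm_num)
  have ho : orderOf (ZMod.unitOfCoprime 5 h5) = 2 ^ m := by
    rw [← orderOf_units, ← ZMod.orderOf_five m]
    rfl
  let r : (ZMod (2 ^ (m + 2)))ˣ →* (ZMod 4)ˣ := ZMod.unitsMap ⟨2 ^ m, by ring⟩
  have hr : ∀ u, u ∈ r.ker ↔ (u : ZMod (2 ^ (m + 2))).val % 4 = 1 := fun u => by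
    rw [MonoidHom.mem_ker, Units.ext_iff, ZMod.unitsMap_val, Units.val_one, ZMod.cast_eq_val,
      ← Nat.cast_one, ZMod.natCast_eq_natCast_iff']
  -- `u ↦ u / 4` is injective on the kernel of reduction, which therefore has order at most `2 ^ m`
  have hcard : Nat.card r.ker ≤ 2 ^ m := by
    have hlt : ∀ u : (ZMod (2 ^ (m + 2)))ˣ, (u : ZMod (2 ^ (m + 2))).val / 4 < 2 ^ m := fun u => by
      have := ZMod.val_lt (u : ZMod (2 ^ (m + 2)))
      rw [Nat.div_lt_iff_lt_mul (by norm_num)]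
      calc _ < 2 ^ (m + 2) := this
        _ = 2 ^ m * 4 := by ring
    have hinj : Function.Injective fun u : r.ker =>
        (⟨(u.1 : ZMod (2 ^ (m + 2))).val / 4, hlt u.1⟩ : Fin (2 ^ m)) := by
      rintro ⟨u, hu⟩ ⟨v, hv⟩ huv
      have h1 := (hr u).mp hu
      have h2 := (hr v).mp hv
      have h3 : (u : ZMod (2 ^ (m + 2))).val / 4 = (v : ZMod (2 ^ (m + 2))).val / 4 :=
        congrArg Fin.val huv
      refine Subtype.ext (Units.ext (ZMod.val_injective _ ?_))
      change (u : ZMod (2 ^ (m + 2))).val = (v : ZMod (2 ^ (m + 2))).val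
      omega
    simpa using Nat.card_le_card_of_injective _ hinj
  have hmem : ZMod.unitOfCoprime 5 h5 ∈ r.ker := by
    rw [MonoidHom.mem_ker, Units.ext_iff]
    change ZMod.castHom (⟨2 ^ m, by ring⟩ : 4 ∣ 2 ^ (m + 2)) (ZMod 4) ((5 : ℕ) : ZMod _) = 1
    rw [map_natCast]
    rfl
  have hcyc : IsCyclic r.ker := by
    refine isCyclic_of_orderOf_eq_card (⟨_, hmem⟩ : r.ker) (le_antisymm ?_ ?_)
    · exact Nat.le_of_dvd Nat.card_pos (orderOf_dvd_natCard _)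
    · rw [Subgroup.orderOf_mk, ho]
      exact hcard
  exact isCyclic_of_injective (f.codRestrict r.ker fun h => (hr _).mpr (h4 (by omega) h))
    ((MonoidHom.injective_codRestrict _ _ _).mpr hf)

/-! ### The inertia group as a Galois group -/

section

variable {F Ω G W : Type*} [Field F] [Field Ω] [Algebra F Ω] [Group G]
  {K : Subgroup G} [hK : K.Normal] [AddCommGroup W] [Module Ω W]
  {lam : Representation Ω K W} {φ : K →* Ω}

/-- The conjugate of a linear character of `K` by `a⁻¹` depends only on the coset `a K`. -/
theorem map_conjNormal_of_mem (φ : K →* Ω) {a b : G} (h : a⁻¹ * b ∈ K) (k : K) :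
    φ (MulAut.conjNormal a⁻¹ k) = φ (MulAut.conjNormal b⁻¹ k) := by
  have h1 : MulAut.conjNormal b⁻¹ k =
      (⟨a⁻¹ * b, h⟩ : K)⁻¹ * MulAut.conjNormal a⁻¹ k * ⟨a⁻¹ * b, h⟩ := by
    apply Subtype.ext
    simp only [MulAut.conjNormal_apply, Subgroup.coe_mul, Subgroup.coe_inv]
    group
  rw [h1, map_mul, map_mul, mul_comm (φ _⁻¹), mul_assoc, ← map_mul, inv_mul_cancel, map_one,
    mul_one]

theorem sum_conjNormal_conjNormal [Fintype (G ⧸ K)] (φ : K →* Ω) (g : G) (k : K) :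
    ∑ q : G ⧸ K, φ (MulAut.conjNormal g (MulAut.conjNormal q.out⁻¹ k)) =
      ∑ q : G ⧸ K, φ (MulAut.conjNormal q.out⁻¹ k) := by
  refine Eq.trans (Finset.sum_congr rfl fun q _ => ?_)
    (_root_.Equiv.sum_comp (Equiv.mulRight ((g⁻¹ : G) : G ⧸ K))
      fun q : G ⧸ K => φ (MulAut.conjNormal q.out⁻¹ k))
  have h1 : MulAut.conjNormal g (MulAut.conjNormal q.out⁻¹ k) =
      MulAut.conjNormal (q.out * g⁻¹)⁻¹ k := by
    rw [mul_inv_rev, inv_inv, map_mul, MulAut.mul_apply]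
  rw [h1]
  refine map_conjNormal_of_mem φ ?_ k
  rw [← QuotientGroup.eq, QuotientGroup.out_eq', QuotientGroup.mk_mul, QuotientGroup.out_eq']
  rfl

/-- `ConjEqGalois` in terms of the linear character `φ` and the conjugation automorphisms of `K`. -/
theorem conjEqGalois_iff (hφ : lam.character = φ) {g : G} {τ : Gal(charField F lam.character/F)} :
    ConjEqGalois F lam g τ ↔ ∀ (k : K) (hk : φ k ∈ charField F lam.character),
      φ (MulAut.conjNormal g k) = (τ ⟨φ k, hk⟩ : Ω) := by
  refine forall_congr' fun k => ?_
  have h1 : φ k = lam.character k := (congrFun hφ k).symm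
  have h2 : φ (MulAut.conjNormal g k) =
      lam.character ⟨g * k * g⁻¹, hK.conj_mem k k.2 g⟩ := (congrFun hφ _).symm
  rw [h2]
  constructor
  · intro h hk
    rw [h]
    congr 3
    exact h1.symm
  · intro h
    rw [h (h1 ▸ mem_charField F _ k)]
    congr 3

theorem ConjEqGalois.mul {a b : G} {σ τ : Gal(charField F lam.character/F)}
    (hφ : lam.character = φ) (hσ : ConjEqGalois F lam a σ) (hτ : ConjEqGalois F lam b τ) :
    ConjEqGalois F lam (a * b) (σ * τ) := by
  rw [conjEqGalois_iff hφ] at hσ hτ ⊢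
  intro k hk
  have hmem : φ (MulAut.conjNormal b k) ∈ charField F lam.character := by
    rw [hτ k hk]
    exact Subtype.prop _
  rw [map_mul, MulAut.mul_apply, hσ _ hmem, AlgEquiv.mul_apply]
  congr 3
  exact hτ k hk

theorem ConjEqGalois.unique {g : G} {σ τ : Gal(charField F lam.character/F)}
    (hσ : ConjEqGalois F lam g σ) (hτ : ConjEqGalois F lam g τ) : σ = τ := by
  have h : (σ : charField F lam.character →ₐ[F] charField F lam.character) = τ := by
    refine IntermediateField.algHom_ext_of_eq_adjoin F (s := Set.range lam.character) rfl ?_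
    rintro _ ⟨k, rfl⟩
    exact Subtype.ext ((hσ k).symm.trans (hτ k))
  exact AlgEquiv.coe_toAlgHom_injective h

theorem mem_of_conjEqGalois_one (hφ : lam.character = φ) (hinj : Function.Injective φ)
    (hcent : ∀ g : G, (∀ k ∈ K, g * k * g⁻¹ = k) → g ∈ K) {g : G}
    (hg : ConjEqGalois F lam g 1) : g ∈ K := by
  rw [conjEqGalois_iff hφ] at hg
  refine hcent g fun k hk => ?_
  have h1 : φ ⟨k, hk⟩ ∈ charField F lam.character := by
    rw [hφ]
    exact mem_charField F φ _
  exact congrArg Subtype.val (hinj (hg ⟨k, hk⟩ h1))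

variable [Fintype (G ⧸ K)] {χ : G → Ω}

theorem charField_le_of_eq_sum_conj (hφ : lam.character = φ)
    (hχ0 : ∀ g ∉ K, χ g = 0)
    (hχK : ∀ k : K, χ k = ∑ q : G ⧸ K, φ (MulAut.conjNormal q.out⁻¹ k)) :
    charField F χ ≤ charField F lam.character := by
  refine IntermediateField.adjoin_le_iff.mpr ?_
  rintro _ ⟨g, rfl⟩
  by_cases hg : g ∈ K
  · rw [SetLike.mem_coe, hχK ⟨g, hg⟩, hφ]
    exact sum_mem fun q _ => mem_charField F φ _
  · rw [hχ0 g hg]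
    exact zero_mem _

theorem ConjEqGalois.charField_le_fixedField (hφ : lam.character = φ)
    (hχ0 : ∀ g ∉ K, χ g = 0)
    (hχK : ∀ k : K, χ k = ∑ q : G ⧸ K, φ (MulAut.conjNormal q.out⁻¹ k)) {g : G}
    {τ : Gal(charField F lam.character/F)} (hτ : ConjEqGalois F lam g τ) :
    charField F χ ≤
      IntermediateField.lift (IntermediateField.fixedField (Subgroup.zpowers τ)) := by
  rw [conjEqGalois_iff hφ] at hτ
  have hmem : ∀ k, φ k ∈ charField F lam.character := fun k => hφ ▸ mem_charField F φ k
  refine IntermediateField.adjoin_le_iff.mpr ?_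
  rintro _ ⟨a, rfl⟩
  by_cases ha : a ∈ K
  · have h1 : χ a ∈ charField F lam.character := by
      rw [hχK ⟨a, ha⟩]
      exact sum_mem fun q _ => hmem _
    rw [SetLike.mem_coe, IntermediateField.mem_lift_fixedField_zpowers h1]
    have h2 : (⟨χ a, h1⟩ : charField F lam.character) =
        ∑ q : G ⧸ K, ⟨φ (MulAut.conjNormal q.out⁻¹ ⟨a, ha⟩), hmem _⟩ := by
      apply Subtype.ext
      rw [AddSubmonoidClass.coe_finsetSum]
      exact hχK ⟨a, ha⟩
    rw [h2, map_sum, AddSubmonoidClass.coe_finsetSum, hχK ⟨a, ha⟩,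
      ← sum_conjNormal_conjNormal φ g]
    exact Finset.sum_congr rfl fun q _ => (hτ _ _).symm
  · rw [hχ0 a ha]
    exact zero_mem _

/-- A Galois automorphism fixing the values of the induced character `χ` permutes the conjugates
of `φ`, because distinct linear characters are linearly independent. -/
theorem exists_conjEqGalois [CharZero Ω] (hφ : lam.character = φ)
    (hχK : ∀ k : K, χ k = ∑ q : G ⧸ K, φ (MulAut.conjNormal q.out⁻¹ k))
    {τ : Gal(charField F lam.character/F)} (hτ : charField F χ ≤
      IntermediateField.lift (IntermediateField.fixedField (Subgroup.zpowers τ))) :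
    ∃ g, ConjEqGalois F lam g τ := by
  have hmem : ∀ k, φ k ∈ charField F lam.character := fun k => hφ ▸ mem_charField F φ k
  let φL : K →* charField F lam.character := φ.codRestrict _ hmem
  let α : G ⧸ K → K →* Ω := fun q => φ.comp (MulAut.conjNormal q.out⁻¹).toMonoidHom
  let β : G ⧸ K → K →* Ω := fun q =>
    ((charField F lam.character).val : _ →* Ω).comp
      ((τ : _ →* charField F lam.character).comp
        (φL.comp (MulAut.conjNormal q.out⁻¹).toMonoidHom))
  have hβ : ∀ q k, β q k = τ ⟨φ (MulAut.conjNormal q.out⁻¹ k), hmem _⟩ := fun _ _ => rfl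
  have hα : ∀ q k, α q k = φ (MulAut.conjNormal q.out⁻¹ k) := fun _ _ => rfl
  have hsum : ∑ q, (⇑(α q) : K → Ω) = ∑ q, ⇑(β q) := by
    funext k
    have h1 : χ k ∈ charField F lam.character := by
      rw [hχK k]
      exact sum_mem fun q _ => hmem _
    have h2 := (IntermediateField.mem_lift_fixedField_zpowers h1).mp (hτ (mem_charField F χ k))
    have h3 : (⟨χ k, h1⟩ : charField F lam.character) =
        ∑ q : G ⧸ K, ⟨φ (MulAut.conjNormal q.out⁻¹ k), hmem _⟩ := by
      apply Subtype.ext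
      rw [AddSubmonoidClass.coe_finsetSum]
      exact hχK k
    rw [h3, map_sum, AddSubmonoidClass.coe_finsetSum, hχK k] at h2
    simp only [Finset.sum_apply, hα, hβ]
    exact h2.symm
  have hfs : ∑ q, Finsupp.single (α q) (1 : Ω) = ∑ q, Finsupp.single (β q) 1 := by
    apply linearIndependent_monoidHom K Ω
    simpa [map_sum] using hsum
  -- the multiplicity of `α 1` on the left is nonzero, hence so is the one on the right
  have hex : ∃ q, β q = α 1 := by
    classical
    by_contra! hne
    have h1 := DFunLike.congr_fun hfs (α 1)
    rw [Finsupp.finsetSum_apply, Finsupp.finsetSum_apply,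
      Finset.sum_eq_zero (f := fun q => Finsupp.single (β q) (1 : Ω) (α 1)) fun q _ =>
        Finsupp.single_eq_of_ne (hne q).symm] at h1
    simp only [Finsupp.single_apply] at h1
    rw [Finset.sum_boole, Nat.cast_eq_zero, Finset.card_eq_zero] at h1
    have : (1 : G ⧸ K) ∈ Finset.univ.filter fun q => α q = α 1 := by simp
    rw [h1] at this
    simp at this
  obtain ⟨q, hq⟩ := hex
  refine ⟨(1 : G ⧸ K).out⁻¹ * q.out, ?_⟩
  rw [conjEqGalois_iff hφ]
  intro k hk
  have h1 := DFunLike.congr_fun hq (MulAut.conjNormal q.out k)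
  rw [hα, hβ] at h1
  have h2 : MulAut.conjNormal q.out⁻¹ (MulAut.conjNormal q.out k) = k := by
    rw [← MulAut.mul_apply, ← map_mul, inv_mul_cancel, map_one, MulAut.one_apply]
  rw [map_mul, MulAut.mul_apply, ← h1]
  congr 3
  rw [h2]

/-- The map `g ↦ τ(g)` identifies `I / K` with the Galois group of `F(lam)` over `F(χ)`. -/
theorem exists_galoisInertia_hom [CharZero Ω] (hφ : lam.character = φ)
    (hinj : Function.Injective φ)
    (hcent : ∀ g : G, (∀ k ∈ K, g * k * g⁻¹ = k) → g ∈ K)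
    (hχ0 : ∀ g ∉ K, χ g = 0)
    (hχK : ∀ k : K, χ k = ∑ q : G ⧸ K, φ (MulAut.conjNormal q.out⁻¹ k))
    (h : charField F χ ≤ charField F lam.character) :
    ∃ T : galoisInertia F lam →* Gal(IntermediateField.extendScalars h/charField F χ),
      Function.Surjective T ∧ T.ker = K.subgroupOf (galoisInertia F lam) ∧
      ∀ g : galoisInertia F lam, ConjEqGalois F lam g (IntermediateField.galRestrict h (T g)) := by
  have hex : ∀ g : galoisInertia F lam, ∃ σ : Gal(IntermediateField.extendScalars h/charField F χ),
      ConjEqGalois F lam g (IntermediateField.galRestrict h σ) := by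
    rintro ⟨g, τ, hτ⟩
    obtain ⟨σ, rfl⟩ := IntermediateField.exists_galRestrict_eq h
      (hτ.charField_le_fixedField hφ hχ0 hχK)
    exact ⟨σ, hτ⟩
  choose t ht using hex
  have huniq : ∀ (g : galoisInertia F lam) σ,
      ConjEqGalois F lam g (IntermediateField.galRestrict h σ) → t g = σ := fun g σ hσ =>
    IntermediateField.galRestrict_injective h ((ht g).unique hσ)
  let T : galoisInertia F lam →* Gal(IntermediateField.extendScalars h/charField F χ) :=
    MonoidHom.mk' t fun a b => huniq _ _ (by
      rw [map_mul]
      exact (ht a).mul hφ (ht b))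
  refine ⟨T, fun σ => ?_, ?_, ht⟩
  · obtain ⟨g, hg⟩ := exists_conjEqGalois hφ hχK
      (IntermediateField.le_lift_fixedField_galRestrict h σ)
    exact ⟨⟨g, _, hg⟩, huniq _ _ hg⟩
  · ext g
    rw [MonoidHom.mem_ker, Subgroup.mem_subgroupOf]
    constructor
    · intro hg
      have h1 := ht g
      rw [show t g = 1 from hg, map_one] at h1
      exact mem_of_conjEqGalois_one hφ hinj hcent h1
    · intro hg
      refine huniq g 1 ?_
      rw [map_one]
      exact fun k => lam.char_conj k ⟨g, hg⟩

end

theorem isPGroup_two_units_two_pow (n : ℕ) : IsPGroup 2 (ZMod (2 ^ n))ˣ := by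
  rcases n with _ | n
  · have : Subsingleton (ZMod (2 ^ 0))ˣ := inferInstanceAs (Subsingleton (ZMod 1)ˣ)
    exact IsPGroup.of_card (n := 0) (by simp)
  · refine IsPGroup.of_card (n := n) ?_
    rw [Nat.card_eq_fintype_card, ZMod.card_units_eq_totient,
      Nat.totient_prime_pow Nat.prime_two n.succ_pos]
    simp

/-- Over a field containing `√-1`, the extension generated by the `2ⁿ`-th roots of unity has a cyclic
Galois group of `2`-power order. -/
theorem isCyclic_gal_two_pow {E A : Type*} [Field E] [Field A] [Algebra E A] {n : ℕ}
    [IsCyclotomicExtension {2 ^ n} E A] (hi : ∃ i : E, i ^ 2 = -1) {ζ : A}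
    (hζ : IsPrimitiveRoot ζ (2 ^ n)) : IsCyclic Gal(A/E) ∧ IsPGroup 2 Gal(A/E) := by
  have hinj := hζ.autToPow_injective E
  refine ⟨isCyclic_of_injective_units_two_pow (hζ.autToPow E) hinj fun hn σ => ?_,
    (isPGroup_two_units_two_pow n).of_injective _ hinj⟩
  have hspec := hζ.autToPow_spec E σ
  obtain ⟨q, hq⟩ : ∃ q, (hζ.autToPow E σ : ZMod (2 ^ n)).val = q + 1 := by
    refine Nat.exists_eq_succ_of_ne_zero fun h0 => ?_
    rw [h0, pow_zero, eq_comm, map_eq_one_iff σ σ.injective] at hspec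
    rw [hspec] at hζ
    have h1 := hζ.eq_orderOf
    rw [orderOf_one, Nat.pow_eq_one] at h1
    omega
  have := four_dvd_of_apply_eq_pow_succ hi hn hζ σ (hq ▸ hspec.symm)
  omega

/-! ### The block of the induced character when the inertia group is everything -/

section

variable {F Ω G W : Type*} [Field F] [CharZero F] [Field Ω] [Algebra F Ω]
  [Algebra.IsAlgebraic F Ω] [Group G] [Finite G]
  {K : Subgroup G} [hK : K.Normal] [IsCyclic K] [AddCommGroup W] [Module Ω W]
  {lam : Representation Ω K W} {φ : K →* Ω} [Fintype (G ⧸ K)] {χ : G → Ω}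

/-- If the extension of `G ⧸ K` by `K` splits, then `F(lam)` with `K` acting by multiplication
through `φ` and the complement acting by Galois automorphisms is a form over `F(χ)` of the
representation with character `χ`. -/
theorem block_of_retraction (hφ : lam.character = φ) (hinj : Function.Injective φ)
    (hχ0 : ∀ g ∉ K, χ g = 0)
    (hχK : ∀ k : K, χ k = ∑ q : G ⧸ K, φ (MulAut.conjNormal q.out⁻¹ k))
    (h : charField F χ ≤ charField F lam.character)
    {τ : G →* Gal(IntermediateField.extendScalars h/charField F χ)}
    (hτ : Function.Surjective τ) (hker : τ.ker = K)
    (hconj : ∀ g, ConjEqGalois F lam g (IntermediateField.galRestrict h (τ g)))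
    {π : G →* G} (hπK : ∀ k ∈ K, π k = 1) (hπ : ∀ g, g * (π g)⁻¹ ∈ K) :
    (∃! e : F[G], IsBlockIdempotent χ e) ∧
      ∀ (e : F[G]) (he : IsBlockIdempotent χ e),
        Nonempty (WedderburnComponent he ≃ₐ[F]
          Matrix (Fin (Nat.card (G ⧸ K))) (Fin (Nat.card (G ⧸ K))) (charField F χ)) := by
  have hmem : ∀ k, φ k ∈ IntermediateField.extendScalars h := fun k => by
    change φ k ∈ charField F lam.character
    rw [hφ]
    exact mem_charField F φ k
  let φL : K →* IntermediateField.extendScalars h := φ.codRestrict _ hmem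
  have hφL : ∀ k, (φL k : Ω) = φ k := fun _ => rfl
  have hτφ : ∀ g k, φL (MulAut.conjNormal g k) = τ g (φL k) := fun g k =>
    Subtype.ext ((conjEqGalois_iff hφ).mp (hconj g) k (hmem k))
  have hτ1 : ∀ g, τ g = 1 ↔ g ∈ K := fun g => by rw [← MonoidHom.mem_ker, hker]
  have hτπ : ∀ g, τ (π g) = τ g := fun g => by
    have := (hτ1 _).mpr (hπ g)
    rw [map_mul, map_inv, mul_inv_eq_one] at this
    exact this.symm
  have hNe : NeZero (Nat.card K) := ⟨Nat.card_pos.ne'⟩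
  obtain ⟨k0, hk0⟩ := IsCyclic.exists_generator (α := K)
  have hprim : IsPrimitiveRoot (φ k0) (Nat.card K) :=
    isPrimitiveRoot_of_forall_mem_zpowers hinj hk0
  have hL : charField F lam.character = F⟮φ k0⟯ := by
    rw [hφ]
    exact charField_eq_adjoin_of_injective hinj hprim
  have hcycE := IntermediateField.isCyclotomicExtension_extendScalars h hprim hL
  have hcycF : IsCyclotomicExtension {Nat.card K} F (IntermediateField.extendScalars h) := by
    have := IntermediateField.isCyclotomicExtension_of_eq_adjoin hprim hL
    exact IsCyclotomicExtension.equiv _ _ _ (IntermediateField.extendScalarsEquiv h).symm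
  have hfd : FiniteDimensional (charField F χ) (IntermediateField.extendScalars h) :=
    IsCyclotomicExtension.finiteDimensional {Nat.card K} _ _
  have hgal : IsGalois (charField F χ) (IntermediateField.extendScalars h) :=
    IsCyclotomicExtension.isGalois {Nat.card K} _ _
  let c : G → IntermediateField.extendScalars h := fun g => φL ⟨g * (π g)⁻¹, hπ g⟩
  have hcK : ∀ k : K, c k = φL k := fun k => by
    refine congrArg φL (Subtype.ext ?_)
    simp [hπK k k.2]
  have hspan : Submodule.span F (c '' τ.ker) = ⊤ := by
    have hprimL : IsPrimitiveRoot (φL k0) (Nat.card K) :=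
      IsPrimitiveRoot.of_map_of_injective (f := (IntermediateField.extendScalars h).val)
        hprim Subtype.val_injective
    have h1 := IsCyclotomicExtension.adjoin_primitive_root_eq_top (A := F) hprimL
    have h2 : Algebra.adjoin F {φL k0} ≤ Algebra.adjoin F (MonoidHom.mrange φL) :=
      Algebra.adjoin_mono (Set.singleton_subset_iff.mpr ⟨k0, rfl⟩)
    have h3 : Submodule.span F (MonoidHom.mrange φL : Set (IntermediateField.extendScalars h)) =
        ⊤ := by
      rw [← Submonoid.closure_eq (MonoidHom.mrange φL), ← Algebra.adjoin_eq_span,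
        Algebra.toSubmodule_eq_top]
      exact top_le_iff.mp (h1 ▸ h2)
    refine top_le_iff.mp (h3 ▸ Submodule.span_mono ?_)
    rintro _ ⟨k, rfl⟩
    exact ⟨k, by rw [hker]; exact k.2, hcK k⟩
  have hcard : Nat.card Gal(IntermediateField.extendScalars h/charField F χ) =
      Nat.card (G ⧸ K) := by
    rw [← Nat.card_congr (QuotientGroup.quotientKerEquivOfSurjective τ hτ).toEquiv, hker]
  refine block_of_cocycle hτ (c := c) ?_ (fun a b => ?_) hspan
    (fun g hg => hχ0 g fun hgK => hg ((hτ1 g).mpr hgK)) (fun g hg => ?_) hcard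
  · rw [← Subgroup.coe_one K, hcK, map_one]
  · change φL _ = φL _ * τ a (φL _)
    rw [← hτπ a, ← hτφ, ← map_mul]
    refine congrArg φL (Subtype.ext ?_)
    rw [Subgroup.coe_mul, MulAut.conjNormal_apply]
    simp only [map_mul]
    group
  · have hg' := (hτ1 g).mp hg
    rw [IsScalarTower.algebraMap_apply (charField F χ) (IntermediateField.extendScalars h) Ω,
      trace_eq_sum_automorphisms, map_sum, show c g = φL ⟨g, hg'⟩ from hcK ⟨g, hg'⟩,
      show χ g = _ from hχK ⟨g, hg'⟩]
    -- the translates of `φ` correspond to its Galois conjugates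
    have hbij : Function.Bijective fun q : G ⧸ K => τ q.out⁻¹ := by
      constructor
      · intro q q' hqq
        have h1 : q.out⁻¹ * q'.out ∈ K := by
          rw [← hτ1, map_mul, show τ q.out⁻¹ = τ q'.out⁻¹ from hqq, ← map_mul, inv_mul_cancel,
            map_one]
        rw [← QuotientGroup.out_eq' q, ← QuotientGroup.out_eq' q']
        exact QuotientGroup.eq.mpr h1
      · intro σ
        obtain ⟨g, rfl⟩ := hτ σ
        refine ⟨((g⁻¹ : G) : G ⧸ K), ?_⟩
        have h1 : ((g⁻¹ : G) : G ⧸ K).out⁻¹ * g⁻¹ ∈ K :=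
          QuotientGroup.eq.mp (QuotientGroup.out_eq' _)
        rw [← hτ1, map_mul, map_inv τ g, mul_inv_eq_one] at h1
        exact h1
    rw [← hbij.sum_comp]
    refine Finset.sum_congr rfl fun q _ => ?_
    rw [← hτφ]
    rfl

end

theorem IsPrimitiveRoot.adjoin_eq_adjoin {F Ω : Type*} [Field F] [Field Ω] [Algebra F Ω] {N : ℕ}
    [NeZero N] {ζ ξ : Ω} (hζ : IsPrimitiveRoot ζ N) (hξ : IsPrimitiveRoot ξ N) : F⟮ζ⟯ = F⟮ξ⟯ := by
  have key : ∀ {a b : Ω}, IsPrimitiveRoot a N → IsPrimitiveRoot b N → F⟮a⟯ ≤ F⟮b⟯ :=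
    fun {a b} ha hb => by
      obtain ⟨i, -, hi⟩ := hb.eq_pow_of_pow_eq_one ha.pow_eq_one
      rw [IntermediateField.adjoin_simple_le_iff, ← hi]
      exact pow_mem (IntermediateField.mem_adjoin_simple_self F b) i
  exact le_antisymm (key hζ hξ) (key hξ hζ)

/-! ### Numerical constraints on the action of a generator of `G ⧸ K` -/

section

variable {G : Type*} [Group G] {K : Subgroup G} {n l q : ℕ} {y : G}

theorem card_dvd_two_pow_mul [IsCyclic K]
    (hcent : ∀ g : G, (∀ k ∈ K, g * k * g⁻¹ = k) → g ∈ K)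
    (hcard : Nat.card K = 2 ^ n) (hy : ∀ k ∈ K, y * k * y⁻¹ = k ^ (q + 1)) (hq : 4 ∣ q)
    (hyl : ∀ j, y ^ j ∈ K ↔ 2 ^ l ∣ j) : 2 ^ n ∣ 2 ^ l * q := by
  obtain ⟨u, hu, hS⟩ := exists_odd_geomSum_two_pow hq l
  have h1 := (pow_mem_iff_card_dvd hcent hy _).mp ((hyl _).mpr dvd_rfl)
  rw [hS, hcard, mul_right_comm] at h1
  exact (Nat.Coprime.pow_left n (Nat.coprime_two_left.mpr hu)).dvd_of_dvd_mul_right h1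

theorem add_two_le_of_four_dvd [IsCyclic K]
    (hcent : ∀ g : G, (∀ k ∈ K, g * k * g⁻¹ = k) → g ∈ K)
    (hcard : Nat.card K = 2 ^ n) (hn : 2 ≤ n) (hy : ∀ k ∈ K, y * k * y⁻¹ = k ^ (q + 1))
    (hq : 4 ∣ q) (hyl : ∀ j, y ^ j ∈ K ↔ 2 ^ l ∣ j) : l + 2 ≤ n := by
  obtain ⟨u, -, hS⟩ := exists_odd_geomSum_two_pow hq (n - 2)
  have h1 : y ^ 2 ^ (n - 2) ∈ K := by
    rw [pow_mem_iff_card_dvd hcent hy, hS, hcard]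
    obtain ⟨s, rfl⟩ := hq
    have h4 : 2 ^ n = 2 ^ (n - 2) * 4 := by
      rw [show (4 : ℕ) = 2 ^ 2 by norm_num, ← pow_add]
      congr 1
      omega
    exact ⟨u * s, by rw [h4]; ring⟩
  rw [hyl, Nat.pow_dvd_pow_iff_le_right (by norm_num)] at h1
  omega

/-- If `K` has order `2`, then it is central and the quotient `G ⧸ K` is trivial. -/
theorem eq_zero_of_card_eq_two (hcent : ∀ g : G, (∀ k ∈ K, g * k * g⁻¹ = k) → g ∈ K)
    (hcard : Nat.card K = 2) (hy : ∀ k ∈ K, y * k * y⁻¹ = k ^ (q + 1))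
    (hyl : ∀ j, y ^ j ∈ K ↔ 2 ^ l ∣ j) : l = 0 := by
  have hsq : ∀ k ∈ K, k ^ 2 = 1 := fun k hk => by
    rw [← hcard]
    exact congrArg Subtype.val (pow_card_eq_one' (x := (⟨k, hk⟩ : K)))
  have h1 : y ^ 1 ∈ K := by
    rw [pow_one]
    refine hcent y fun k hk => ?_
    rcases Nat.even_or_odd' q with ⟨s, rfl | rfl⟩
    · rw [hy k hk, pow_succ, pow_mul, hsq k hk, one_pow, one_mul]
    · -- for odd `q`, conjugation by `y` sends `k` to `k ^ (q + 1) = 1`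
      have h2 := hy k hk
      rw [show 2 * s + 1 + 1 = 2 * (s + 1) by ring, pow_mul, hsq k hk, one_pow,
        conj_eq_one_iff] at h2
      rw [h2]
      group
  rw [hyl, Nat.dvd_one, Nat.pow_eq_one] at h1
  omega

end

/-! ### The block of a faithful irreducible representation -/

theorem theorem7p0p3
    {F Ω G V W : Type*} [Field F] [CharZero F] [Field Ω] [Algebra F Ω] [IsAlgClosure F Ω]
    (hi : ∃ i : F, i ^ 2 = -1)
    [Group G] [Finite G] (hG : derivedSeries G 2 = ⊥)
    (K : Subgroup G) [K.Normal] [IsCyclic K]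
    (hKmax : Maximal (fun H : Subgroup G => H.Normal ∧ IsMulCommutative H) K)
    (hKG : commutator G ≤ K)
    (n : ℕ) (hn : 0 < n) (hcard : Nat.card K = 2 ^ n)
    [AddCommGroup V] [Module Ω V] [FiniteDimensional Ω V]
    (ρ : Representation Ω G V) (hρ : ρ.IsIrreducible) (hfaith : Function.Injective ρ)
    [AddCommGroup W] [Module Ω W] [FiniteDimensional Ω W]
    (lam : Representation Ω K W) (hlam : lam.IsIrreducible)
    (hconst : ∃ f : Representation.IntertwiningMap lam (MonoidHom.comp ρ K.subtype),
      Function.Injective f) :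
    -- first part
    (Function.Injective lam ∧
      Nonempty (ρ.Equiv (lam.ind K.subtype)) ∧
      (∀ ζ : Ω, IsPrimitiveRoot ζ (2 ^ n) → charField F lam.character = F⟮ζ⟯) ∧
      (∃ h : charField F ρ.character ≤ charField F lam.character,
        IsGalois (charField F ρ.character) (IntermediateField.extendScalars h) ∧
        Nonempty ((galoisInertia F lam ⧸ K.subgroupOf (galoisInertia F lam)) ≃*
          Gal(IntermediateField.extendScalars h/charField F ρ.character))) ∧
      IsCyclic (galoisInertia F lam ⧸ K.subgroupOf (galoisInertia F lam)) ∧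
      IsPGroup 2 (galoisInertia F lam ⧸ K.subgroupOf (galoisInertia F lam))) ∧
    -- second part
    (galoisInertia F lam = ⊤ →
      (∃ (l : ℕ) (y : G), Subgroup.zpowers (y : G ⧸ K) = ⊤ ∧ Nat.card (G ⧸ K) = 2 ^ l) ∧
      ∀ (l : ℕ) (y : G), Subgroup.zpowers (y : G ⧸ K) = ⊤ → Nat.card (G ⧸ K) = 2 ^ l →
        (∃ σ : Gal(charField F lam.character/F), ConjEqGalois F lam y σ ∧
          charField F ρ.character =
            IntermediateField.lift (IntermediateField.fixedField (Subgroup.zpowers σ))) ∧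
        ((∃! e : F[G], IsBlockIdempotent ρ.character e) ∧
          ∀ (e : F[G]) (he : IsBlockIdempotent ρ.character e),
            Nonempty (WedderburnComponent he ≃ₐ[F]
              Matrix (Fin (2 ^ l)) (Fin (2 ^ l)) (charField F ρ.character))) ∧
        ∃ m : ℕ, 2 ≤ m ∧
          ∀ ζ : Ω, IsPrimitiveRoot ζ (2 ^ m) → charField F ρ.character = F⟮ζ⟯) := by
  have : IsAlgClosed Ω := IsAlgClosure.isAlgClosed F
  have : Algebra.IsAlgebraic F Ω := IsAlgClosure.isAlgebraic
  have : CharZero Ω := charZero_of_injective_algebraMap (algebraMap F Ω).injective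
  have : IsMulCommutative K := hKmax.prop.2
  have hcent : ∀ g : G, (∀ k ∈ K, g * k * g⁻¹ = k) → g ∈ K := fun g hg =>
    mem_of_forall_commute_of_maximal hKmax hKG hg
  have : Fintype (G ⧸ K) := Fintype.ofFinite _
  have : NeZero (Nat.card K) := ⟨Nat.card_pos.ne'⟩
  obtain ⟨φ, hlamφ, hφ⟩ := hlam.exists_linearCharacter
  obtain ⟨w, hw0, hw⟩ := finrank_eq_one_iff'.mp (hlam.finrank_eq_one_of_isMulCommutative lam)
  obtain ⟨f, hf⟩ := hconst
  have hv0 : f w ≠ 0 := fun h => hw0 (hf (h.trans (map_zero f).symm))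
  have hφv : ∀ k : K, ρ k (f w) = φ k • f w := fun k => by
    have := LinearMap.congr_fun (f.isIntertwining' k) w
    simp only [LinearMap.comp_apply, hlamφ, map_smul] at this
    exact this.symm
  have hinj := injective_of_eigenvector hρ hfaith hv0 hφv
  obtain ⟨b, hb⟩ := exists_basis_translates hρ hcent hv0 hφv hinj
  have hχ0 : ∀ g ∉ K, ρ.character g = 0 := fun g hg => character_eq_zero_of_basis b hb hφv hg
  have hχK : ∀ k : K, ρ.character k = ∑ q : G ⧸ K, φ (MulAut.conjNormal q.out⁻¹ k) := fun k => by
    rw [character_eq_sum_conj_of_basis b hb hφv]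
    refine Finset.sum_congr rfl fun q _ => congrArg φ (Subtype.ext ?_)
    simp
  have h := charField_le_of_eq_sum_conj hφ hχ0 hχK (F := F)
  obtain ⟨T, hTsurj, hTker, hT⟩ := exists_galoisInertia_hom hφ hinj hcent hχ0 hχK h
  obtain ⟨k0, hk0⟩ := IsCyclic.exists_generator (α := K)
  have hprim : IsPrimitiveRoot (φ k0) (Nat.card K) :=
    isPrimitiveRoot_of_forall_mem_zpowers hinj hk0
  have hL : ∀ ζ : Ω, IsPrimitiveRoot ζ (Nat.card K) → charField F lam.character = F⟮ζ⟯ :=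
    fun ζ hζ => by
      rw [hφ]
      exact charField_eq_adjoin_of_injective hinj hζ
  have hcyc := IntermediateField.isCyclotomicExtension_extendScalars h hprim (hL _ hprim)
  have hfd : FiniteDimensional (charField F ρ.character) (IntermediateField.extendScalars h) :=
    IsCyclotomicExtension.finiteDimensional {Nat.card K} _ _
  have hgal : IsGalois (charField F ρ.character) (IntermediateField.extendScalars h) :=
    IsCyclotomicExtension.isGalois {Nat.card K} _ _
  have hiE : ∃ i : charField F ρ.character, i ^ 2 = -1 := by
    obtain ⟨i, hi⟩ := hi
    exact ⟨algebraMap F _ i, by rw [← map_pow, hi, map_neg, map_one]⟩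
  have hζmem : φ k0 ∈ IntermediateField.extendScalars h := by
    change φ k0 ∈ charField F lam.character
    rw [hφ]
    exact mem_charField F φ k0
  have hprimL : IsPrimitiveRoot (⟨φ k0, hζmem⟩ : IntermediateField.extendScalars h) (2 ^ n) := by
    rw [← hcard]
    exact IsPrimitiveRoot.of_map_of_injective (f := (IntermediateField.extendScalars h).val)
      hprim Subtype.val_injective
  have hgalcyc : IsCyclic Gal(IntermediateField.extendScalars h/charField F ρ.character) ∧
      IsPGroup 2 Gal(IntermediateField.extendScalars h/charField F ρ.character) := by
    rw [hcard] at hcyc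
    exact isCyclic_gal_two_pow hiE hprimL
  obtain ⟨hGcyc, hGp⟩ := hgalcyc
  let eI : (galoisInertia F lam ⧸ K.subgroupOf (galoisInertia F lam)) ≃*
      Gal(IntermediateField.extendScalars h/charField F ρ.character) :=
    (QuotientGroup.quotientMulEquivOfEq hTker.symm).trans
      (QuotientGroup.quotientKerEquivOfSurjective T hTsurj)
  refine ⟨⟨fun a b hab => ?_, nonempty_equiv_ind_of_basis b f w hw hb hlamφ,
    fun ζ hζ => hL ζ (hcard ▸ hζ), ⟨h, hgal, ⟨eI⟩⟩,
    isCyclic_of_surjective eI.symm eI.symm.surjective, hGp.of_equiv eI.symm⟩, fun hI => ?_⟩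
  · refine hinj (smul_left_injective Ω hw0 ?_)
    change φ a • w = φ b • w
    rw [← hlamφ, ← hlamφ, hab]
  let τ : G →* Gal(IntermediateField.extendScalars h/charField F ρ.character) :=
    T.comp ((MonoidHom.id G).codRestrict (galoisInertia F lam) fun g => hI ▸ Subgroup.mem_top g)
  have hτ : Function.Surjective τ := fun σ => by
    obtain ⟨g, rfl⟩ := hTsurj σ
    exact ⟨g, rfl⟩
  have hker : τ.ker = K := by
    ext g
    change _ ∈ T.ker ↔ _
    rw [hTker]
    rfl
  have hconj : ∀ g, ConjEqGalois F lam g (IntermediateField.galRestrict h (τ g)) := fun g =>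
    hT ⟨g, hI ▸ Subgroup.mem_top g⟩
  let eG : G ⧸ K ≃* Gal(IntermediateField.extendScalars h/charField F ρ.character) :=
    (QuotientGroup.quotientMulEquivOfEq hker.symm).trans
      (QuotientGroup.quotientKerEquivOfSurjective τ hτ)
  refine ⟨?_, fun l y hgen hl => ?_⟩
  · obtain ⟨l, hl⟩ := IsPGroup.iff_card.mp (hGp.of_equiv eG.symm)
    have : IsCyclic (G ⧸ K) := isCyclic_of_surjective eG.symm eG.symm.surjective
    obtain ⟨x, hx⟩ := IsCyclic.exists_generator (α := G ⧸ K)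
    obtain ⟨y, rfl⟩ := QuotientGroup.mk_surjective x
    exact ⟨l, y, (Subgroup.eq_top_iff' _).mpr hx, hl⟩
  have hE : charField F ρ.character = IntermediateField.lift (IntermediateField.fixedField
      (Subgroup.zpowers (IntermediateField.galRestrict h (τ y)))) := by
    refine le_antisymm (IntermediateField.le_lift_fixedField_galRestrict h _) fun x hx => ?_
    have hxL := IntermediateField.lift_le _ hx
    rw [IntermediateField.mem_lift_fixedField_zpowers hxL,
      IntermediateField.coe_galRestrict_apply] at hx
    have hstab : ∀ σ : Gal(IntermediateField.extendScalars h/charField F ρ.character),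
        σ ⟨x, hxL⟩ = ⟨x, hxL⟩ := by
      have hle : Subgroup.zpowers (eG (y : G ⧸ K)) ≤ MulAction.stabilizer
          Gal(IntermediateField.extendScalars h/charField F ρ.character)
          (⟨x, hxL⟩ : IntermediateField.extendScalars h) := by
        rw [Subgroup.zpowers_le]
        exact Subtype.ext hx
      intro σ
      refine hle ?_
      obtain ⟨z, rfl⟩ := eG.surjective σ
      obtain ⟨j, rfl⟩ : z ∈ Subgroup.zpowers (y : G ⧸ K) := hgen ▸ Subgroup.mem_top z
      exact ⟨j, (map_zpow eG _ j).symm⟩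
    obtain ⟨e, he⟩ := (IsGalois.mem_bot_iff_fixed _).mpr hstab
    have := congrArg Subtype.val he
    rw [← show (e : Ω) = x from this]
    exact e.2
  obtain ⟨q, hq⟩ := exists_conj_eq_pow K y
  have hyl : ∀ j, y ^ j ∈ K ↔ 2 ^ l ∣ j := fun j => by
    rw [pow_mem_iff_of_zpowers_eq_top hgen, hl]
  have hconjk : ∀ k : K, MulAut.conjNormal y k = k ^ (q + 1) := fun k =>
    Subtype.ext (hq k k.2)
  have hτζ : τ y ⟨φ k0, hζmem⟩ = ⟨φ k0, hζmem⟩ ^ (q + 1) := by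
    apply Subtype.ext
    have := (conjEqGalois_iff hφ).mp (hconj y) k0 hζmem
    rw [hconjk, map_pow] at this
    exact this.symm
  have hq4 : 2 ≤ n → 4 ∣ q := fun hn2 => four_dvd_of_apply_eq_pow_succ hiE hn2 hprimL (τ y) hτζ
  have hl0 : n < 2 → l = 0 := fun hn2 => by
    obtain rfl : n = 1 := by omega
    exact eq_zero_of_card_eq_two hcent (by simpa using hcard) hq hyl
  refine ⟨⟨_, hconj y, hE⟩, ?_, ?_⟩
  · obtain ⟨k, hk, hky⟩ := exists_mul_pow_eq_one hcent hcard hq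
      (fun hl' => hq4 (by by_contra hn2; exact hl' (hl0 (by omega)))) hyl
    have hmk : ((k * y : G) : G ⧸ K) = y := by
      rw [QuotientGroup.mk_mul, (QuotientGroup.eq_one_iff k).mpr hk, one_mul]
    obtain ⟨π, hπK, hπ⟩ := exists_retraction (y := k * y) (by rw [hmk]; exact hgen)
      (by rw [hl]; exact hky)
    have := block_of_retraction hφ hinj hχ0 hχK h hτ hker hconj hπK hπ
    rwa [hl] at this
  rcases Nat.lt_or_ge n 2 with hn2 | hn2
  · -- here `F(lam) = F(-1) = F`, and `F(ζ₄) = F` because `F` contains a square root of `-1`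
    refine ⟨2, le_rfl, fun ζ hζ => ?_⟩
    obtain rfl : n = 1 := by omega
    have h1 : φ k0 = -1 := IsPrimitiveRoot.eq_neg_one_of_two_right (by simpa [hcard] using hprim)
    have h2 : F⟮ζ⟯ = ⊥ := by
      rw [IntermediateField.adjoin_simple_eq_bot_iff]
      obtain ⟨i, hi⟩ := hi
      have h3 : ζ ^ 2 = algebraMap F Ω i ^ 2 := by
        have := hζ.pow_two_pow_sub_two_sq_eq_neg_one le_rfl
        rw [← map_pow, hi, map_neg, map_one, ← this]
        simp
      rcases sq_eq_sq_iff_eq_or_eq_neg.mp h3 with h4 | h4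
      · exact h4 ▸ IntermediateField.algebraMap_mem _ i
      · exact h4 ▸ neg_mem (IntermediateField.algebraMap_mem _ i)
    have h3 : charField F lam.character = ⊥ := by
      rw [hL _ hprim, h1, IntermediateField.adjoin_simple_eq_bot_iff]
      exact neg_mem (one_mem _)
    rw [h2]
    exact le_bot_iff.mp (h3 ▸ h)
  · have hln := add_two_le_of_four_dvd hcent hcard hn2 hq (hq4 hn2) hyl
    have hdvd := card_dvd_two_pow_mul hcent hcard hq (hq4 hn2) hyl
    refine ⟨n - l, by omega, fun ζ hζ => ?_⟩
    have hmemL : φ k0 ^ 2 ^ l ∈ charField F lam.character := pow_mem hζmem _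
    have hmem : φ k0 ^ 2 ^ l ∈ charField F ρ.character := by
      rw [hE, IntermediateField.mem_lift_fixedField_zpowers hmemL]
      have h1 := (conjEqGalois_iff hφ).mp (hconj y) (k0 ^ 2 ^ l) (by rw [map_pow]; exact hmemL)
      have h2 : (k0 ^ 2 ^ l) ^ q = 1 := by
        rw [← pow_mul]
        exact orderOf_dvd_iff_pow_eq_one.mp
          (by rwa [orderOf_eq_card_of_forall_mem_zpowers hk0, hcard])
      rw [hconjk, pow_succ, h2, one_mul] at h1
      simp only [map_pow] at h1
      exact h1.symm
    have hfin : Module.finrank (charField F ρ.character) (IntermediateField.extendScalars h) =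
        2 ^ l := by
      rw [← IsGalois.card_aut_eq_finrank, ← Nat.card_congr eG.toEquiv, hl]
    rw [IntermediateField.eq_adjoin_pow_of_finrank_eq h (hL _ hprim) hmem hfin]
    refine IsPrimitiveRoot.adjoin_eq_adjoin (N := 2 ^ (n - l)) ?_ hζ
    refine hprim.pow Nat.card_pos ?_
    rw [hcard, ← pow_add]
    congr 1
    omega
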